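/- Let $\mathbf{Man}$ be the category of finite-dimensional smooth manifolds (Hausdorff, second countable, without boundary) and smooth maps. For a manifold $U$ let $C^\infty_{\mathbb{R},U}$ be its sheaf of smooth real-valued functions, let $\mathbf{Sh}_{C^\infty_{\mathbb{R}}}(U)$ be the category of sheaves of $C^\infty_{\mathbb{R},U}$-modules with its symmetric monoidal structure $\otimes_{C^\infty_{\mathbb{R},U}}$ (the sheafified tensor product), and for a smooth map $h:U\to U'$ let $h^*:\mathbf{Sh}_{C^\infty_{\mathbb{R}}}(U')\to \mathbf{Sh}_{C^\infty_{\mathbb{R}}}(U)$, $h^*W = h^{-1}W\otimes_{h^{-1}C^\infty_{\mathbb{R},U'}}C^\infty_{\mathbb{R},U}$, be the inverse image functor (left adjoint to the direct image $h_*$). The prestack (pseudofunctor) $\mathbf{PoVec}^\infty_{\mathbb{R}}:\mathbf{Man}^{\mathrm{op}}\to\mathbf{Cat}$ is defined as follows. To a manifold $U$ it assigns the category whose objects are pairs $(W,\tau)$ with $W\in \mathbf{Sh}_{C^\infty_{\mathbb{R}}}(U)$ and $\tau: W\otimes_{C^\infty_{\mathbb{R},U}}W\to C^\infty_{\mathbb{R},U}$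 an antisymmetric morphism of sheaves of $C^\infty_{\mathbb{R},U}$-modules (that is, $\tau\circ\mathrm{swap}=-\tau$), and whose morphisms $(W,\tau)\to (W',\tau')$ are the morphisms $\psi:W\to W'$ of sheaves of $C^\infty_{\mathbb{R},U}$-modules with $\tau'\circ(\psi\otimes\psi)=\tau$. To a smooth map $h:U\to U'$ it assigns the functor $h^*$ sending $(W,\tau)$ to $h^*W$ with the pairing $$h^*W\otimes_{C^\infty_{\mathbb{R},U}} h^*W\;\cong\; h^*\big(W\otimes_{C^\infty_{\mathbb{R},U'}} W\big)\xrightarrow{\;h^*\tau\;} h^*C^\infty_{\mathbb{R},U'}\;\cong\; C^\infty_{\mathbb{R},U},$$ and sending a morphism $\psi$ to $h^*\psi$. Its coherence isomorphisms $h^*h'^*\cong (h'\circ h)^*$ and $\mathrm{id}^*\cong\mathrm{id}$ are the canonical ones of inverse images of sheaves of modules. **Proposition.** $\mathbf{PoVec}^\infty_{\mathbb{R}}$ is a stack. That is, for every manifold $U$ and every open cover $\{U_\alpha\subseteq U\}$, the canonical functor $(W,\tau)\mapsto \big((W,\tau)|_{U_\alpha}\big)_\alpha$ from $\mathbf{PoVec}^\infty_{\mathbb{R}}(U)$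 to the descent category $\mathbf{PoVec}^\infty_{\mathbb{R}}(\{U_\alpha\subseteq U\})$ is an equivalence of categories. Here an object of the descent category is a family of objects $x_\alpha\in \mathbf{PoVec}^\infty_{\mathbb{R}}(U_\alpha)$ together with isomorphisms $\varphi_{\alpha\beta}:x_\alpha|_{U_\alpha\cap U_\beta}\to x_\beta|_{U_\alpha\cap U_\beta}$ such that, up to the coherence isomorphisms, $\varphi_{\alpha\alpha}=\mathrm{id}$ and $\varphi_{\beta\gamma}\circ\varphi_{\alpha\beta}=\varphi_{\alpha\gamma}$ on $U_\alpha\cap U_\beta\cap U_\gamma$; a morphism $(x_\alpha,\varphi_{\alpha\beta})\to (y_\alpha,\chi_{\alpha\beta})$ is a family of morphisms $\psi_\alpha:x_\alpha\to y_\alpha$ with $\chi_{\alpha\beta}\circ\psi_\alpha|_{U_\alpha\cap U_\beta}=\psi_\beta|_{U_\alpha\cap U_\beta}\circ\varphi_{\alpha\beta}$; and $|_{\widetilde U}$ denotes the inverse image along the inclusion. -/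

import Mathlib

universe u

namespace SmoothStack

open CategoryTheory Opposite TopologicalSpace MonoidalCategory Limits

/-- The sheaf of rings underlying a sheaf of commutative rings `A` on a topological space. -/
abbrev ringSheaf {X : TopCat.{u}} (A : TopCat.Sheaf CommRingCat.{u} X) :
    Sheaf (Opens.grothendieckTopology X) RingCat.{u} :=
  ⟨A.obj ⋙ forget₂ CommRingCat.{u} RingCat.{u},
    ((sheafCompose _ (forget₂ CommRingCat.{u} RingCat.{u})).obj A).property⟩

/-- Sheaves of `A`-modules. -/
abbrev Modules {X : TopCat.{u}} (A : TopCat.Sheaf CommRingCat.{u} X) :=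
  SheafOfModules.{u} (ringSheaf A)

noncomputable section
variable {X Y Z : TopCat.{u}} {A : TopCat.Sheaf CommRingCat.{u} X} {B : TopCat.Sheaf CommRingCat.{u} Y}

/-- Sections of a sheaf of modules over an open set. -/
abbrev Sec (M : Modules A) (O : Opens X) := M.val.obj (op O)

/-- Sections of the sheaf of rings over an open set. -/
abbrev Fn (A : TopCat.Sheaf CommRingCat.{u} X) (O : Opens X) := (ringSheaf A).obj.obj (op O)

/-- Restriction of sections. -/
def res (M : Modules A) {O O' : Opens X} (h : O ≤ O') (x : Sec M O') : Sec M O :=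
  M.val.map (homOfLE h).op x

/-- Restriction of sections of the sheaf of rings. -/
def resRing (A : TopCat.Sheaf CommRingCat.{u} X) {O O' : Opens X} (h : O ≤ O') :
    Fn A O' →+* Fn A O  :=
  ((ringSheaf A).obj.map (homOfLE h).op).hom

variable {M N P : Modules A}

lemma res_add {O O' : Opens X} (h : O ≤ O') (x y : Sec M O') :
    res M h (x+y) = res M h x + res M h y :=
  map_add _ _ _

lemma res_smul {O O' : Opens X} (h : O ≤ O') (a : Fn A O') (x : Sec M O') :
   res M h (a • x) = resRing A h a • res M h x :=
  M.val.map_smul _ _ _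

lemma res_res {O O' O'' : Opens X} (h : O ≤ O') (h' : O' ≤ O'') (x : Sec M O'') :
    res M h (res M h' x) = res M (h.trans h') x :=
  (M.val.map_comp_apply (homOfLE h').op (homOfLE h).op x).symm

lemma res_self {O : Opens X} (h : O ≤ O) (x : Sec M O) :
    res M h x = x :=
  congr($(M.val.presheaf.map_id _) x)

lemma resRing_resRing {O O' O'' : Opens X} (h : O ≤ O') (h' : O' ≤ O'') (x : Fn A O'') :
    resRing A h (resRing A h' x) = resRing A (h.trans h') x :=
  congr($((ringSheaf A).obj.map_comp (homOfLE h').op (homOfLE h).op) x).symm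

/-- A morphism of sheaves of modules on sections. -/
def ap (f : M ⟶ N) (O : Opens X) : Sec M O →ₗ[Fn A O] Sec N O := (f.val.app (op O)).hom

lemma ap_res (f : M ⟶ N) {O O' : Opens X} (h : O ≤ O') (x : Sec M O') :
    ap f O (res M h x) = res N h (ap f O' x) :=
  PresheafOfModules.naturality_apply f.val (homOfLE h).op x

lemma ap_ext {f g : M ⟶ N} (h : ∀ O x, ap f O x = ap g O x) : f = g := by
  ext O x
  exact h _ _

lemma ap_comp (f : M ⟶ N) (g : N ⟶ P) (O : Opens X) (x : Sec M O) :
    ap (f ≫ g) O x = ap g O (ap f O x) := rfl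

lemma ap_id (O : Opens X) (x : Sec M O) : ap (𝟙 M) O x = x := rfl

lemma ap_add (f g : M ⟶ N) (O : Opens X) (x : Sec M O) : ap (f + g) O x = ap f O x + ap g O x := rfl

lemma ap_neg (f : M ⟶ N) (O : Opens X) (x : Sec M O) : ap (-f) O x = - ap f O x := rfl

/-- The morphism of sheaves of modules given by a compatible family of linear maps. -/
def mkHom (f : ∀ O : Opens X, Sec M O →ₗ[Fn A O] Sec N O)
    (hf : ∀ (O O' : Opens X) (h : O ≤ O') x, f O (res M h x) = res N h (f O' x)) : M ⟶ N where
  val :=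
    { app O := ModuleCat.ofHom (f O.unop)
      naturality {O O'} i := by
        ext x
        exact hf _ _ (leOfHom i.unop) x }

lemma ap_mkHom (f : ∀ O : Opens X, Sec M O →ₗ[Fn A O] Sec N O) (hf) (O : Opens X) (x) :
   ap (mkHom (M := M) (N := N) f hf) O x = f O x := rfl

/- Pushforward. -/
/-- Morphisms of sheaves of rings `B ⟶ f_* A`, making `f` a morphism of ringed spaces. -/
abbrev RingMap (f : X ⟶ Y) (A : TopCat.Sheaf CommRingCat.{u} X) (B : TopCat.Sheaf CommRingCat.{u} Y) :=
  ringSheaf B ⟶ ((Opens.map f).sheafPushforwardContinuous RingCat.{u} (Opens.grothendieckTopology Y)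
    (Opens.grothendieckTopology X)).obj (ringSheaf A)

variable {f : X ⟶ Y} (φ : RingMap f A B)

instance instIsRightAdjointPushforward : (SheafOfModules.pushforward.{u} φ).IsRightAdjoint := by
  have h : (PresheafOfModules.pushforward.{u} (F := Opens.map f) (R := (ringSheaf A).obj)
    (S := (ringSheaf B).obj) φ.hom).IsRightAdjoint := PresheafOfModules.instIsRightAdjointPushforward _
  exact (@SheafOfModules.PullbackConstruction.adjunction _ _ _ _ _ _ _ _ _ _ φ h _ _).isRightAdjoint

/-- The direct image of sheaves of modules. -/
abbrev push : Modules A ⥤ Modules B := SheafOfModules.pushforward.{u} φ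
/-- The inverse image `M ↦ f⁻¹ M ⊗_{f⁻¹ B} A` of sheaves of modules, that is, the left adjoint of the
direct image. -/
abbrev pull : Modules B ⥤ Modules A := SheafOfModules.pullback.{u} φ
/-- The adjunction between inverse and direct image. -/
abbrev adj : pull φ ⊣ push φ := SheafOfModules.pullbackPushforwardAdjunction.{u} φ

/-- The map `B(O) → A(f⁻¹ O)` given by a morphism of sheaves of rings `B ⟶ f_* A`. -/
def co (O : Opens Y) : Fn B O →+* Fn A ((Opens.map f).obj O) := (φ.hom.app (op O)).hom

lemma co_res {O O' : Opens Y} (h : O ≤ O') (a : Fn B O') :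
    co φ O (resRing B h a) = resRing A ((Opens.map f).map (homOfLE h)).le (co φ O' a) :=
  congr($(φ.hom.naturality (homOfLE h).op) a)

/-- Sections of the direct image. -/
def pushSec (M : Modules A) (O : Opens Y) : Sec ((push φ).obj M) O ≃+ Sec M ((Opens.map f).obj O) :=
  AddEquiv.refl _

lemma pushSec_smul (M : Modules A) (O : Opens Y) (a : Fn B O) (x) :
   pushSec φ M O (a • x) = co φ O a • pushSec φ M O x := rfl

lemma pushSec_res (M : Modules A) {O O' : Opens Y} (h : O ≤ O') (x) :
   pushSec φ M O (res _ h x) = res M ((Opens.map f).map (homOfLE h)).le (pushSec φ M O' x) := rfl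

/-- The canonical map `M(O) → (f^* M)(f⁻¹ O)`, given by the unit of the adjunction. -/
def eta (M : Modules B) (O : Opens Y) (x : Sec M O) : Sec ((pull φ).obj M) ((Opens.map f).obj O) :=
  pushSec φ _ O (ap ((adj φ).unit.app M) O x)

lemma eta_add (M : Modules B) (O : Opens Y) (x y : Sec M O) :
    eta φ M O (x + y) = eta φ M O x + eta φ M O y := by
  simp only [eta, map_add]

lemma eta_smul (M : Modules B) (O : Opens Y) (a : Fn B O) (x : Sec M O) :
    eta φ M O (a • x) = co φ O a • eta φ M O x := by
  exact congrArg (pushSec φ _ O) ((ap ((adj φ).unit.app M) O).map_smul a x)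

lemma eta_res (M : Modules B) {O O' : Opens Y} (h : O ≤ O') (x : Sec M O') :
    eta φ M O (res M h x) = res _ ((Opens.map f).map (homOfLE h)).le (eta φ M O' x) := by
  exact congrArg (pushSec φ _ O) (ap_res ((adj φ).unit.app M) h x)

lemma ap_push_map {M N : Modules A} (g : M ⟶ N) (O : Opens Y) (x) :
    pushSec φ N O (ap ((push φ).map g) O x) = ap g _ (pushSec φ M O x) := rfl

lemma ap_map_eta {M N : Modules B} (g : M ⟶ N) (O : Opens Y) (x : Sec M O) :
    ap ((pull φ).map g) _ (eta φ M O x) = eta φ N O (ap g O x) := by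
  have h := (adj φ).unit.naturality g
  exact congr(pushSec φ _ O (ap $h O x)).symm

lemma ap_lift_eta {M : Modules B} {N : Modules A} (g : M ⟶ (push φ).obj N) (O : Opens Y)
    (x : Sec M O) :
    ap (((adj φ).homEquiv M N).symm g) _ (eta φ M O x) = pushSec φ N O (ap g O x) := by
  have h : (adj φ).homEquiv M N (((adj φ).homEquiv M N).symm g) = g := Equiv.apply_symm_apply _ _
  rw [Adjunction.homEquiv_unit] at h
  exact congr(pushSec φ _ O (ap $h O x))

lemma pull_hom_ext {M : Modules B} {N : Modules A} {g g' : (pull φ).obj M ⟶ N}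
    (h : ∀ O x, ap g _ (eta φ M O x) = ap g' _ (eta φ M O x)) : g = g' := by
  apply ((adj φ).homEquiv M N).injective
  rw [Adjunction.homEquiv_unit, Adjunction.homEquiv_unit]
  exact ap_ext h

/- Local sections. -/

/-- Intersecting with a fixed open set `Q`. -/
def interFunctor (Q : Opens X) : Opens X ⥤ Opens X where
  obj O := Q ⊓ O
  map i := homOfLE (inf_le_inf_left Q i.le)

instance (Q : Opens X) : (interFunctor Q).IsContinuous (Opens.grothendieckTopology X)
    (Opens.grothendieckTopology X) := by
  let j : TopCat.of Q ⟶ X := TopCat.ofHom ⟨Subtype.val, continuous_subtype_val⟩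
  have hj : Topology.IsOpenEmbedding j := Q.isOpen.isOpenEmbedding_subtypeVal
  have : (Opens.map j).IsContinuous (Opens.grothendieckTopology X)
    (Opens.grothendieckTopology (TopCat.of Q)) :=
    Functor.isContinuous_of_coverPreserving
      (compatiblePreserving_opens_map j) (coverPreserving_opens_map j)
  have e : Opens.map j ⋙ hj.isOpenMap.functor ≅ interFunctor Q :=
    NatIso.ofComponents (fun O => eqToIso (by
      ext x
      constructor
      · rintro ⟨y, hy, rfl⟩
        exact ⟨y.2, hy⟩
      · rintro ⟨h1, h2⟩
        exact ⟨⟨x, h1⟩, h2, rfl⟩)) (fun _ => rfl)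
  have : hj.isOpenMap.functor.IsContinuous (Opens.grothendieckTopology (TopCat.of Q)) (Opens.grothendieckTopology X)  := hj.functor_isContinuous
  have : (Opens.map j ⋙ hj.isOpenMap.functor).IsContinuous (Opens.grothendieckTopology X)
    (Opens.grothendieckTopology X) := Functor.isContinuous_comp _ _ _ (Opens.grothendieckTopology (TopCat.of Q)) _
  exact Functor.isContinuous_of_iso e _ _

/-- The sheaf `O ↦ P (Q ∩ O)`. -/
def loc (P : Modules A) (Q : Opens X) : Modules A :=
  (SheafOfModules.pushforward.{u} (F := interFunctor Q) (S := ringSheaf A) (R := ringSheaf A)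
    ⟨{ app := fun O => (ringSheaf A).obj.map (homOfLE inf_le_right).op
       naturality := fun O O' i => by
        exact ((ringSheaf A).obj.map_comp _ _).symm.trans
          ((ringSheaf A).obj.map_comp _ ((interFunctor Q).op.map i))}⟩).obj P

/-- Sections of `loc P Q`. -/
def locSec (P : Modules A) (Q O : Opens X) : Sec (loc P Q) O ≃+ Sec P (Q ⊓ O) := AddEquiv.refl _

lemma locSec_smul (P : Modules A) (Q O : Opens X) (a : Fn A O) (x) :
   locSec P Q O (a • x) = resRing A (inf_le_right : Q ⊓ O ≤ O) a • locSec P Q O x := rfl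

lemma locSec_res (P : Modules A) (Q : Opens X) {O O' : Opens X} (h : O ≤ O') (x) :
   locSec P Q O (res _ h x) = res P (inf_le_inf_left Q h) (locSec P Q O' x) := rfl

/-- Restriction of sections as a morphism. -/
def locRes (P : Modules A) {Q Q' : Opens X} (h : Q ≤ Q') : loc P Q' ⟶ loc P Q :=
  mkHom (fun O =>
    { toFun := fun x => (locSec P Q O).symm (res P (inf_le_inf_right O h) (locSec P Q' O x))
      map_add' := fun x y => res_add _ _ _
      map_smul' := fun a x => by
        exact (res_smul (M := P) (inf_le_inf_right O h)
          (resRing A (inf_le_right : Q' ⊓ O ≤ O) a) (locSec P Q' O x)).trans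
          (congrArg (fun r : Fn A (Q ⊓ O) => r • res P (inf_le_inf_right O h) (locSec P Q' O x))
            (resRing_resRing _ _ a)) })
    (fun O O' h' x => (res_res _ _ (locSec P Q' O' x)).trans (res_res _ _ (locSec P Q' O' x)).symm)

lemma locSec_locRes (P : Modules A) {Q Q' : Opens X} (h : Q ≤ Q') (O : Opens X) (x) :
    locSec P Q O (ap (locRes P h) O x) = res P (inf_le_inf_right O h) (locSec P Q' O x) := rfl

/-- Multiplication by a function as a morphism. -/
def locMul (P : Modules A) {Q : Opens X} (c : Fn A Q) : loc P Q ⟶ loc P Q :=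
  mkHom (fun O =>
    { toFun := fun x => (locSec P Q O).symm
        (resRing A (inf_le_left : Q ⊓ O ≤ Q) c • locSec P Q O x)
      map_add' := fun x y => smul_add (resRing A (inf_le_left : Q ⊓ O ≤ Q) c)
        (locSec P Q O x) (locSec P Q O y)
      map_smul' := fun a x => smul_comm (resRing A (inf_le_left : Q ⊓ O ≤ Q) c)
        (resRing A (inf_le_right : Q ⊓ O ≤ O) a) (locSec P Q O x) })
    (fun O O' h' x => by
      refine Eq.trans ?_ (res_smul (M := P) (inf_le_inf_left Q h') _ (locSec P Q O' x)).symm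
      rw [resRing_resRing]
      rfl)

lemma locSec_locMul (P : Modules A) {Q : Opens X} (c : Fn A Q) (O : Opens X) (x) :
    locSec P Q O (ap (locMul P c) O x) = resRing A (inf_le_left : Q ⊓ O ≤ Q) c • locSec P Q O x :=
  rfl

/- Bilinear maps. -/

/-- Bilinear maps of sheaves of modules. -/
@[ext]
structure Bilin (M N P : Modules A) where
  app : ∀ O : Opens X, Sec M O → Sec N O → Sec P O
  add_left : ∀ O x x' y, app O (x + x') y = app O x y + app O x' y
  add_right : ∀ O x y y', app O x (y + y') = app O x y + app O x y'
  smul_left : ∀ O (a : Fn A O) x y, app O (a • x) y = a • app O x y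
  smul_right : ∀ O (a : Fn A O) x y, app O x (a • y) = a • app O x y
  res_app : ∀ (O O' : Opens X) (h : O ≤ O') x y,
    app O (res M h x) (res N h y) = res P h (app O' x y)

namespace Bilin

/-- A bilinear map with first argument fixed. -/
def fixLeft (b : Bilin M N P) {Q : Opens X} (m : Sec M Q) : N ⟶ loc P Q :=
  mkHom (fun O =>
    { toFun := fun y => (locSec P Q O).symm
        (b.app (Q ⊓ O) (res M inf_le_left m) (res N inf_le_right y))
      map_add' := fun y y' => by rw [res_add, b.add_right]; rfl
      map_smul' := fun a y => by rw [res_smul, b.smul_right]; rfl })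
    (fun O O' h y => by
      refine Eq.trans ?_ (b.res_app _ _ (inf_le_inf_left Q h) _ _)
      rw [res_res, res_res]
      change b.app _ _ (res N _ (res N _ y)) = _
      rw [res_res])

/-- A bilinear map with second argument fixed. -/
def fixRight (b : Bilin M N P) {Q : Opens X} (n : Sec N Q) : M ⟶ loc P Q :=
  mkHom (fun O =>
    { toFun := fun x => (locSec P Q O).symm
        (b.app (Q ⊓ O) (res M inf_le_right x) (res N inf_le_left n))
      map_add' := fun y y' => by rw [res_add, b.add_left]; rfl
      map_smul' := fun a y => by rw [res_smul, b.smul_left]; rfl })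
    (fun O O' h y => by
      refine Eq.trans ?_ (b.res_app _ _ (inf_le_inf_left Q h) _ _)
      rw [res_res, res_res]
      change b.app _ (res M _ (res M _ y)) _ = _
      rw [res_res])

lemma locSec_fixLeft (b : Bilin M N P) {Q : Opens X} (m : Sec M Q) (O y) :
    locSec P Q O (ap (b.fixLeft m) O y) =
      b.app (Q ⊓ O) (res M inf_le_left m) (res N inf_le_right y) := rfl

lemma locSec_fixRight (b : Bilin M N P) {Q : Opens X} (n : Sec N Q) (O x) :
    locSec P Q O (ap (b.fixRight n) O x) =
      b.app (Q ⊓ O) (res M inf_le_right x) (res N inf_le_left n) := rfl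

lemma app_res_left (b : Bilin M N P) {Q O : Opens X} (h : O ≤ Q) (m : Sec M Q) (n : Sec N O) :
    b.app O (res M h m) n = res P (le_inf h le_rfl) (locSec P Q O (ap (b.fixLeft m) O n)) := by
  rw [locSec_fixLeft, ← b.res_app, res_res, res_res, res_self]

lemma app_res_right (b : Bilin M N P) {Q O : Opens X} (h : O ≤ Q) (m : Sec M O) (n : Sec N Q) :
    b.app O m (res N h n) = res P (le_inf h le_rfl) (locSec P Q O (ap (b.fixRight n) O m)) := by
  rw [locSec_fixRight, ← b.res_app, res_res, res_res, res_self]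

theorem pull_ext {M N : Modules B} {P : Modules A}
    {c c' : Bilin ((pull φ).obj M) ((pull φ).obj N) P}
    (h : ∀ O m n, c.app _ (eta φ M O m) (eta φ N O n) = c'.app _ (eta φ M O m) (eta φ N O n)) :
    c = c' := by
  have h1 (O) (m : Sec M O) : c.fixLeft (eta φ M O m) = c'.fixLeft (eta φ M O m) := by
    apply pull_hom_ext
    intro O' n
    apply (locSec P _ _).injective
    rw [locSec_fixLeft, locSec_fixLeft]
    have := h (O ⊓ O') (res M inf_le_left m) (res N inf_le_right n)
    rw [eta_res, eta_res] at this
    exact this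
  have h2 (Q) (n : Sec ((pull φ).obj N) Q) : c.fixRight n = c'.fixRight n := by
    apply pull_hom_ext
    intro O m
    apply (locSec P _ _).injective
    rw [locSec_fixRight, locSec_fixRight, app_res_left, app_res_left, h1]
  ext O x y
  rw [← res_self le_rfl y, app_res_right, app_res_right, h2]

/- Extension. -/
section extend
variable {φ} {M N : Modules B} {P : Modules A} (b : Bilin M N ((push φ).obj P))

/-- The value of a bilinear map to a direct image, as a section over the preimage. -/
def val (O : Opens Y) (m : Sec M O) (n : Sec N O) : Sec P ((Opens.map f).obj O) :=
  pushSec φ P O (b.app O m n)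

variable (φ P) in
/-- Direct images commute with localization at `Q`. -/
def pushLoc (Q : Opens Y) :
    loc ((push φ).obj P) Q ⟶ (push φ).obj (loc P ((Opens.map f).obj Q)) :=
  mkHom (fun O =>
    { toFun := fun x => (pushSec φ (loc P _) O).symm ((locSec P _ _).symm
        (pushSec φ P _ (locSec _ Q O x)))
      map_add' := fun _ _ => rfl
      map_smul' := fun a x => congrArg
        (fun r : Fn A ((Opens.map f).obj (Q ⊓ O)) => r • pushSec φ P _ (locSec _ Q O x))
        (co_res φ (inf_le_right : Q ⊓ O ≤ O) a) })
    (fun _ _ _ _ => rfl)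

/-- The extension of `b m` to the inverse image of `N`, for a section `m` of `M`. -/
def beta {O : Opens Y} (m : Sec M O) : (pull φ).obj N ⟶ loc P ((Opens.map f).obj O) :=
  ((adj φ).homEquiv _ _).symm (b.fixLeft m ≫ pushLoc φ P O)

lemma beta_eta {O O' : Opens Y} (m : Sec M O) (n : Sec N O') :
    locSec P _ _ (ap (b.beta m) _ (eta φ N O' n)) =
      b.val (O ⊓ O') (res M inf_le_left m) (res N inf_le_right n) :=
  congrArg (locSec P _ _) (ap_lift_eta φ _ _ n)

lemma beta_add {O : Opens Y} (m m' : Sec M O) : b.beta (m + m') = b.beta m + b.beta m' := by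
  apply pull_hom_ext
  intro O' n
  apply (locSec P _ _).injective
  rw [ap_add, map_add, beta_eta, beta_eta, beta_eta, res_add]
  exact b.add_left _ _ _ _

lemma beta_smul {O : Opens Y} (a : Fn B O) (m : Sec M O) :
    b.beta (a • m) = b.beta m ≫ locMul P (co φ O a) := by
  apply pull_hom_ext
  intro O' n
  apply (locSec P _ _).injective
  rw [ap_comp, locSec_locMul, beta_eta, beta_eta, res_smul]
  refine (b.smul_left _ _ _ _).trans ?_
  exact congrArg (fun r : Fn A ((Opens.map f).obj (O ⊓ O')) => r • b.val (O ⊓ O') (res M inf_le_left m) (res N inf_le_right n))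
        (co_res φ (inf_le_left : O ⊓ O' ≤ O) a)

lemma beta_res {O O' : Opens Y} (h : O ≤ O') (m : Sec M O') :
    b.beta (res M h m) = b.beta m ≫ locRes P ((Opens.map f).map (homOfLE h)).le := by
  apply pull_hom_ext
  intro O1 n
  apply (locSec P _ _).injective
  rw [ap_comp, locSec_locRes, beta_eta, beta_eta, res_res]
  have := b.res_app _ _ (inf_le_inf_right O1 h) (res M inf_le_left m) (res N inf_le_right n)
  rw [res_res, res_res] at this
  exact congrArg (pushSec φ P _) this

/-- The map `m ↦ b.beta m t`, for a section `t` of the inverse image of `N`. -/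
def gamma {Q : Opens X} (t : Sec ((pull φ).obj N) Q) : M ⟶ (push φ).obj (loc P Q) :=
  mkHom (fun O =>
    { toFun := fun s => (pushSec φ (loc P Q) O).symm ((locSec P _ _).symm
        (res P (le_of_eq (inf_comm _ _)) (locSec P _ _ (ap (b.beta s) Q t))))
      map_add' := fun x y => by
        rw [beta_add, ap_add, map_add, res_add]; rfl
      map_smul' := fun a x => by
        rw [beta_smul, ap_comp, locSec_locMul, res_smul, resRing_resRing]
        rfl })
    (fun O O' h x => by
      change res P _ (locSec P _ _ (ap (b.beta (res M h x)) Q t)) =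
        res P (inf_le_inf_left Q ((Opens.map f).map (homOfLE h)).le)
          (res P _ (locSec P _ _ (ap (b.beta x) Q t)))
      rw [beta_res, ap_comp, locSec_locRes, res_res]
      exact (res_res (M := P) (inf_le_inf_left Q ((Opens.map f).map (homOfLE h)).le) _ _).symm)

lemma locSec_gamma {Q : Opens X} (t : Sec ((pull φ).obj N) Q) (O : Opens Y) (m : Sec M O) :
    locSec P Q _ (pushSec φ (loc P Q) O (ap (b.gamma t) O m)) =
      res P (le_of_eq (inf_comm _ _)) (locSec P _ _ (ap (b.beta m) Q t)) := rfl

/-- The extension of `b.gamma t` to the inverse image of `M`. -/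
def gammaHat {Q : Opens X} (t : Sec ((pull φ).obj N) Q) : (pull φ).obj M ⟶ loc P Q :=
  ((adj φ).homEquiv _ _).symm (b.gamma t)

lemma gammaHat_eta {Q : Opens X} (t : Sec ((pull φ).obj N) Q) (O : Opens Y) (m : Sec M O) :
    locSec P Q _ (ap (b.gammaHat t) _ (eta φ M O m)) =
      res P (le_of_eq (inf_comm _ _)) (locSec P _ _ (ap (b.beta m) Q t)) := by
  rw [← locSec_gamma]
  exact congrArg (locSec P _ _) (ap_lift_eta φ _ _ m)

lemma gammaHat_add {Q : Opens X} (t t' : Sec ((pull φ).obj N) Q) :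
    b.gammaHat (t + t') = b.gammaHat t + b.gammaHat t' := by
  apply pull_hom_ext
  intro O m
  apply (locSec P _ _).injective
  rw [ap_add, map_add, gammaHat_eta, gammaHat_eta, gammaHat_eta, map_add, map_add, res_add]

lemma gammaHat_smul {Q : Opens X} (a : Fn A Q) (t : Sec ((pull φ).obj N) Q) :
    b.gammaHat (a • t) = b.gammaHat t ≫ locMul P a := by
  apply pull_hom_ext
  intro O m
  apply (locSec P _ _).injective
  rw [ap_comp, locSec_locMul, gammaHat_eta, gammaHat_eta, map_smul, locSec_smul, res_smul,
    resRing_resRing]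

lemma gammaHat_res {Q Q' : Opens X} (h : Q ≤ Q') (t : Sec ((pull φ).obj N) Q') :
    b.gammaHat (res _ h t) = b.gammaHat t ≫ locRes P h := by
  apply pull_hom_ext
  intro O m
  apply (locSec P _ _).injective
  rw [ap_comp, locSec_locRes, gammaHat_eta, gammaHat_eta, ap_res, locSec_res, res_res, res_res]

/-- The extension of a bilinear map to the inverse images. -/
def extend : Bilin ((pull φ).obj M) ((pull φ).obj N) P where
  app Q x t := res P (le_inf le_rfl le_rfl) (locSec P Q Q (ap (b.gammaHat t) Q x))
  add_left Q x x' t := by rw [map_add, map_add, res_add]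
  add_right Q x t t' := by rw [gammaHat_add, ap_add, map_add, res_add]
  smul_left Q a x t := by
    rw [map_smul, locSec_smul, res_smul, resRing_resRing]
    exact congrArg (fun r : Fn A Q => r • _) congr($((ringSheaf A).obj.map_id _) a)
  smul_right Q a x t := by
    rw [gammaHat_smul, ap_comp, locSec_locMul, res_smul, resRing_resRing]
    exact congrArg (fun r : Fn A Q => r • _) congr($((ringSheaf A).obj.map_id _) a)
  res_app Q Q' h x t := by
    rw [gammaHat_res, ap_comp, locSec_locRes, ap_res, locSec_res, res_res, res_res, res_res]

lemma extend_eta (O : Opens Y) (m : Sec M O) (n : Sec N O) :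
    b.extend.app _ (eta φ M O m) (eta φ N O n) = pushSec φ P O (b.app O m n) := by
  change res P _ (locSec P _ _ (ap (b.gammaHat _) _ _)) = _
  rw [gammaHat_eta, res_res, beta_eta]
  have := b.res_app _ _ (le_inf le_rfl le_rfl) (res M (inf_le_left : O ⊓ O ≤ O) m)
    (res N inf_le_right n)
  rw [res_res, res_res, res_self, res_self] at this
  rw [this]
  rfl

end extend

end Bilin

/- Tensor product. -/
/-- The presheaf `O ↦ M(O) ⊗_{A(O)} N(O)`. -/
abbrev ptens (M N : Modules A) : PresheafOfModules.{u} (ringSheaf A).obj :=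
  MonoidalCategory.tensorObj
    (C := PresheafOfModules.{u} (A.obj ⋙ forget₂ CommRingCat.{u} RingCat.{u})) M.val N.val

/-- Sheafification of presheaves of modules. -/
abbrev shf (A : TopCat.Sheaf CommRingCat.{u} X) :
    PresheafOfModules.{u} (ringSheaf A).obj ⥤ Modules A :=
  PresheafOfModules.sheafification.{u} (R := ringSheaf A) (𝟙 (ringSheaf A).obj)

/-- The adjunction between sheafification and the inclusion. -/
abbrev shfAdj (A : TopCat.Sheaf CommRingCat.{u} X) :=
  PresheafOfModules.sheafificationAdjunction.{u} (R := ringSheaf A) (𝟙 (ringSheaf A).obj)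

/-- The tensor product `M ⊗_A N` of sheaves of `A`-modules: the sheafification of the presheaf
`O ↦ M(O) ⊗_{A(O)} N(O)`. -/
def tens (M N : Modules A) : Modules A := (shf A).obj (ptens M N)

/-- The morphism `g ⊗ g'`. -/
def tensMap {M M' N N' : Modules A} (g : M ⟶ M') (g' : N ⟶ N') : tens M N ⟶ tens M' N' :=
  (shf A).map (MonoidalCategory.tensorHom
    (C := PresheafOfModules.{u} (A.obj ⋙ forget₂ CommRingCat.{u} RingCat.{u})) g.val g'.val)

/-- The symmetry `M ⊗ N ⟶ N ⊗ M`, `m ⊗ n ↦ n ⊗ m`. -/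
def tensSwap (M N : Modules A) : tens M N ⟶ tens N M :=
  (shf A).map (BraidedCategory.braiding
    (C := PresheafOfModules.{u} (A.obj ⋙ forget₂ CommRingCat.{u} RingCat.{u})) M.val N.val).hom

/-- The section `m ⊗ n` of the tensor product. -/
def tmul (O : Opens X) (m : Sec M O) (n : Sec N O) : Sec (tens M N) O :=
  ((shfAdj A).unit.app (ptens M N)).app (op O)
   (TensorProduct.tmul (Fn A O) (M := M.val.obj (op O)) (N := N.val.obj (op O)) m n)

lemma tmul_bilin_aux {L : PresheafOfModules.{u} (ringSheaf A).obj} {g g' : ptens M N ⟶ L}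
   (h : ∀ O (m : Sec M O) (n : Sec N O),
    g.app (op O) (TensorProduct.tmul (Fn A O) (M := M.val.obj (op O)) (N := N.val.obj (op O)) m n) =
     g'.app (op O) (TensorProduct.tmul (Fn A O) (M := M.val.obj (op O)) (N := N.val.obj (op O)) m n)) : g = g' := by
  apply PresheafOfModules.hom_ext
  intro O
  apply ModuleCat.MonoidalCategory.tensor_ext
  intro m n
  exact h _ m n

lemma tens_hom_ext {g g' : tens M N ⟶ P}
    (h : ∀ O m n, ap g O (tmul O m n) = ap g' O (tmul O m n)) : g = g' := by
  apply ((shfAdj A).homEquiv _ _).injective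
  refine (Adjunction.homEquiv_unit (shfAdj A) (ptens M N) P g).trans
    (Eq.trans ?_ (Adjunction.homEquiv_unit (shfAdj A) (ptens M N) P g').symm)
  apply tmul_bilin_aux
  intro O m n
  exact h O m n

lemma ap_tensMap {M M' N N' : Modules A} (g : M ⟶ M') (g' : N ⟶ N') (O m n) :
    ap (tensMap g g') O (tmul O m n) = tmul O (ap g O m) (ap g' O n) := by
  have := (shfAdj A).unit.naturality (MonoidalCategory.tensorHom
    (C := PresheafOfModules.{u} (A.obj ⋙ forget₂ CommRingCat.{u} RingCat.{u})) g.val g'.val)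
  exact congr($(this).app (op O) (TensorProduct.tmul (Fn A O) (M := M.val.obj (op O)) (N := N.val.obj (op O)) m n)).symm

lemma ap_tensSwap (O) (m : Sec M O) (n : Sec N O) :
    ap (tensSwap M N) O (tmul O m n) = tmul O n m := by
  have := (shfAdj A).unit.naturality (BraidedCategory.braiding
    (C := PresheafOfModules.{u} (A.obj ⋙ forget₂ CommRingCat.{u} RingCat.{u})) M.val N.val).hom
  exact congr($(this).app (op O) (TensorProduct.tmul (Fn A O) (M := M.val.obj (op O)) (N := N.val.obj (op O)) m n)).symm

/-- The universal bilinear map `(m, n) ↦ m ⊗ n`. -/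
def tmulBilin (M N : Modules A) : Bilin M N (tens M N) where
  app O m n := tmul O m n
  add_left O x x' y := by
    refine Eq.trans ?_ (map_add (((shfAdj A).unit.app (ptens M N)).app (op O)).hom _ _)
    exact congrArg _ (TensorProduct.add_tmul (R := Fn A O) x x' y)
  add_right O x y y' := by
    refine Eq.trans ?_ (map_add (((shfAdj A).unit.app (ptens M N)).app (op O)).hom _ _)
    exact congrArg _ (TensorProduct.tmul_add (R := Fn A O) x y y')
  smul_left O a x y := by
    refine Eq.trans ?_ ((((shfAdj A).unit.app (ptens M N)).app (op O)).hom.map_smul a _)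
    exact congrArg (((shfAdj A).unit.app (ptens M N)).app (op O)).hom
      (TensorProduct.smul_tmul' (R := Fn A O) a x y).symm
  smul_right O a x y := by
    refine Eq.trans ?_ ((((shfAdj A).unit.app (ptens M N)).app (op O)).hom.map_smul a _)
    exact congrArg _ (TensorProduct.tmul_smul (R := Fn A O) a x y)
  res_app O O' h x y :=
    PresheafOfModules.naturality_apply ((shfAdj A).unit.app (ptens M N)) (homOfLE h).op
      (TensorProduct.tmul (Fn A O') (M := M.val.obj (op O')) (N := N.val.obj (op O')) x y)

/-- The morphism from the presheaf tensor product induced by a bilinear map. -/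
def Bilin.liftP (b : Bilin M N P) : ptens M N ⟶ P.val where
  app O := ModuleCat.MonoidalCategory.tensorLift (R := Fn A O.unop)
    (M₁ := M.val.obj O) (M₂ := N.val.obj O)
    (fun m n => b.app O.unop m n) (b.add_left _) (b.smul_left _) (b.add_right _) (b.smul_right _)
  naturality {O O'} i := by
    apply ModuleCat.MonoidalCategory.tensor_ext
    intro m n
    exact b.res_app _ _ (leOfHom i.unop) m n

/-- The morphism from the tensor product induced by a bilinear map. -/
def Bilin.lift (b : Bilin M N P) : tens M N ⟶ P :=
  ((shfAdj A).homEquiv _ _).symm b.liftP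

lemma Bilin.ap_lift (b : Bilin M N P) (O m n) : ap b.lift O (tmul O m n) = b.app O m n := by
  have h : (shfAdj A).homEquiv _ _ b.lift = b.liftP := Equiv.apply_symm_apply _ _
  replace h := (Adjunction.homEquiv_unit (shfAdj A) (ptens M N) P b.lift).symm.trans h
  exact congr(($h).app (op O) (TensorProduct.tmul (Fn A O) (M := M.val.obj (op O)) (N := N.val.obj (op O)) m n))

/-- A bilinear map followed by a morphism. -/
def Bilin.comp (b : Bilin M N P) {P' : Modules A} (g : P ⟶ P') : Bilin M N P' where
  app O m n := ap g O (b.app O m n)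
  add_left O x x' y := by rw [b.add_left, map_add]
  add_right O x x' y := by rw [b.add_right, map_add]
  smul_left O x x' y := by rw [b.smul_left, map_smul]
  smul_right O x x' y := by rw [b.smul_right, map_smul]
  res_app O O' h x y := by rw [b.res_app, ap_res]

/- Pulling back pairings. -/

section pullTens
variable {M N : Modules B} {P : Modules A}

/-- The restriction of a bilinear map on inverse images along the units of the adjunction. -/
def Bilin.restr (b : Bilin ((pull φ).obj M) ((pull φ).obj N) P) :
    Bilin M N ((push φ).obj P) where
  app O m n := (pushSec φ P O).symm (b.app _ (eta φ M O m) (eta φ N O n))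
  add_left O x x' y := by rw [eta_add, b.add_left]; rfl
  add_right O x x' y := by rw [eta_add, b.add_right]; rfl
  smul_left O x x' y := by rw [eta_smul, b.smul_left]; rfl
  smul_right O x x' y := by rw [eta_smul, b.smul_right]; rfl
  res_app O O' h x y := by rw [eta_res, eta_res, b.res_app]; rfl

lemma pullTens_ext {g g' : tens ((pull φ).obj M) ((pull φ).obj N) ⟶ P}
    (h : ∀ O m n, ap g _ (tmul _ (eta φ M O m) (eta φ N O n)) =
      ap g' _ (tmul _ (eta φ M O m) (eta φ N O n))) : g = g' := by
  apply tens_hom_ext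
  have : (tmulBilin _ _).comp g = (tmulBilin _ _).comp g' := Bilin.pull_ext φ h
  intro O m n
  exact congr(($this).app O m n)

lemma pull_tens_hom_ext {g g' : (pull φ).obj (tens M N) ⟶ P}
    (h : ∀ O m n, ap g _ (eta φ _ O (tmul O m n)) = ap g' _ (eta φ _ O (tmul O m n))) :
    g = g' := by
  apply ((adj φ).homEquiv _ _).injective
  rw [Adjunction.homEquiv_unit, Adjunction.homEquiv_unit]
  exact tens_hom_ext h

variable (M N) in
/-- The canonical isomorphism between the inverse image of a tensor product and the tensor product
of the inverse images. -/
def pullTensIso : (pull φ).obj (tens M N) ≅ tens ((pull φ).obj M) ((pull φ).obj N) where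
  hom := ((adj φ).homEquiv _ _).symm (tmulBilin ((pull φ).obj M) ((pull φ).obj N)).restr.lift
  inv := ((tmulBilin M N).comp ((adj φ).unit.app (tens M N))).extend.lift
  hom_inv_id := by
    apply pull_tens_hom_ext
    intro O m n
    rw [ap_comp, ap_lift_eta, ap_id, Bilin.ap_lift]
    refine (Bilin.ap_lift _ _ _ _).trans ?_
    rw [Bilin.extend_eta]
    rfl
  inv_hom_id := by
    apply pullTens_ext
    intro O m n
    rw [ap_comp, Bilin.ap_lift, Bilin.extend_eta, ap_id]
    refine (ap_lift_eta φ _ _ (tmul O m n)).trans ?_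
    rw [Bilin.ap_lift]
    rfl

lemma pullTensIso_inv_tmul (O : Opens Y) (m : Sec M O) (n : Sec N O) :
    ap (pullTensIso φ M N).inv _ (tmul _ (eta φ M O m) (eta φ N O n)) = eta φ _ O (tmul O m n) := by
  refine (Bilin.ap_lift _ _ _ _).trans ?_
  rw [Bilin.extend_eta]
  rfl

end pullTens

/-- The structure sheaf as a module over itself. -/
abbrev unitM (A : TopCat.Sheaf CommRingCat.{u} X) : Modules A := SheafOfModules.unit (ringSheaf A)

/-- Sections of the structure sheaf as a module. -/
def unitSec (A : TopCat.Sheaf CommRingCat.{u} X) (O : Opens X) : Fn A O ≃+ Sec (unitM A) O :=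
  AddEquiv.refl _

/-- The canonical morphism from the inverse image of the structure sheaf to the structure sheaf. -/
def pullUnit : (pull φ).obj (unitM B) ⟶ unitM A :=
  SheafOfModules.pullbackObjUnitToUnit φ

/-- `co` as an additive map between sections of the unit modules. -/
def coUnit (O : Opens Y) : Sec (unitM B) O →+ Sec (unitM A) ((Opens.map f).obj O) :=
  (unitSec A _).toAddMonoidHom.comp
    ((co φ O).toAddMonoidHom.comp (unitSec B O).symm.toAddMonoidHom)

lemma ap_pullUnit_eta (O : Opens Y) (a : Sec (unitM B) O) :
    ap (pullUnit φ) _ (eta φ _ O a) = coUnit φ O a :=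
  ap_lift_eta φ _ O a

/-- The inverse image of a pairing:
`f^* M ⊗ f^* M ≅ f^* (M ⊗ M) ⟶ f^* B ≅ A`, the middle map being `f^* τ`. -/
def pullPairing {M : Modules B} (τ : tens M M ⟶ unitM B) :
    tens ((pull φ).obj M) ((pull φ).obj M) ⟶ unitM A :=
  (pullTensIso φ M M).inv ≫ (pull φ).map τ ≫ pullUnit φ

lemma ap_pullPairing {M : Modules B} (τ : tens M M ⟶ unitM B) (O : Opens Y) (m n : Sec M O) :
    ap (pullPairing φ τ) _ (tmul _ (eta φ M O m) (eta φ M O n)) =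
      coUnit φ O (ap τ O (tmul O m n)) := by
  rw [pullPairing, ap_comp, ap_comp, pullTensIso_inv_tmul, ap_map_eta, ap_pullUnit_eta]

lemma tensSwap_pullPairing {M : Modules B} (τ : tens M M ⟶ unitM B) :
    tensSwap _ _ ≫ pullPairing φ τ = pullPairing φ (tensSwap M M ≫ τ) :=
  pullTens_ext φ fun O m n => by
    rw [ap_comp, ap_tensSwap, ap_pullPairing, ap_pullPairing, ap_comp, ap_tensSwap]

lemma pullPairing_neg {M : Modules B} (τ : tens M M ⟶ unitM B) :
    pullPairing φ (-τ) = -pullPairing φ τ := by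
  have : (push φ).Additive := ⟨ap_ext fun _ _ => rfl⟩
  have : (pull φ).Additive := (adj φ).left_adjoint_additive
  rw [pullPairing, pullPairing, Functor.map_neg, Preadditive.neg_comp, Preadditive.comp_neg]

/- Poisson modules. -/

/-- A sheaf of `A`-modules `W` with an antisymmetric morphism `τ : W ⊗_A W ⟶ A`. -/
structure PoissonModule (A : TopCat.Sheaf CommRingCat.{u} X) where
  module : Modules A
  pairing : tens module module ⟶ unitM A
  antisymm : tensSwap module module ≫ pairing = -pairing

namespace PoissonModule

/-- Morphisms `ψ` of sheaves of modules with `τ' ∘ (ψ ⊗ ψ) = τ`. -/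
@[ext]
structure Hom (V W : PoissonModule A) where
  hom : V.module ⟶ W.module
  comm : tensMap hom hom ≫ W.pairing = V.pairing

lemma tensMap_id (M N : Modules A) : tensMap (𝟙 M) (𝟙 N) = 𝟙 (tens M N) :=
  tens_hom_ext fun O m n => by rw [ap_tensMap, ap_id, ap_id, ap_id]

lemma tensMap_comp {M M' M'' N N' N'' : Modules A} (g : M ⟶ M') (g' : M' ⟶ M'')
    (k : N ⟶ N') (k' : N' ⟶ N'') :
    tensMap (g ≫ g') (k ≫ k') = tensMap g k ≫ tensMap g' k' :=
  tens_hom_ext fun O m n => by simp only [ap_comp, ap_tensMap]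

instance : Category (PoissonModule A) where
  Hom := Hom
  id V := { hom := 𝟙 _, comm := by rw [tensMap_id, Category.id_comp] }
  comp f g :=
    { hom := f.hom ≫ g.hom
      comm := by rw [tensMap_comp, Category.assoc, g.comm, f.comm] }

@[ext]
lemma hom_ext {V W : PoissonModule A} {f g : V ⟶ W} (h : f.hom = g.hom) : f = g := Hom.ext h

@[simp] lemma id_hom (V : PoissonModule A) : Hom.hom (𝟙 V) = 𝟙 _ := rfl
@[simp] lemma comp_hom {V W W' : PoissonModule A} (f : V ⟶ W) (g : W ⟶ W') :
    (f ≫ g).hom = f.hom ≫ g.hom := rfl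

/-- An isomorphism of sheaves of modules compatible with the pairings. -/
def isoMk {V W : PoissonModule A} (e : V.module ≅ W.module)
    (h : tensMap e.hom e.hom ≫ W.pairing = V.pairing) : V ≅ W where
  hom := ⟨e.hom, h⟩
  inv := ⟨e.inv, by rw [← h, ← Category.assoc, ← tensMap_comp, e.inv_hom_id, tensMap_id,
    Category.id_comp]⟩

/-- The inverse image functor. -/
def pullback : PoissonModule B ⥤ PoissonModule A where
  obj V :=
    { module := (pull φ).obj V.module
      pairing := pullPairing φ V.pairing
      antisymm := by rw [tensSwap_pullPairing, V.antisymm, pullPairing_neg] }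
  map {V W} g :=
    { hom := (pull φ).map g.hom
      comm := by
        apply pullTens_ext
        intro O m n
        rw [ap_comp, ap_tensMap, ap_map_eta, ap_map_eta, ap_pullPairing, ap_pullPairing,
          ← ap_tensMap, ← ap_comp, g.comm] }
  map_id V := hom_ext ((pull φ).map_id V.module)
  map_comp g g' := hom_ext ((pull φ).map_comp g.hom g'.hom)

end PoissonModule

/- Coherence. -/

section comp
variable {g : Y ⟶ Z} {C : TopCat.Sheaf CommRingCat.{u} Z} (ψ : RingMap g B C)
  (θ : RingMap (f ≫ g) A C)
  (hθ : ∀ (O : Opens Z) (a : Fn C O), co θ O a = co φ ((Opens.map g).obj O) (co ψ O a))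

lemma pull_pull_hom_ext {M : Modules C} {N : Modules A}
    {k k' : (pull φ).obj ((pull ψ).obj M) ⟶ N}
    (h : ∀ O m, ap k _ (eta φ _ _ (eta ψ M O m)) = ap k' _ (eta φ _ _ (eta ψ M O m))) :
    k = k' := by
  apply ((adj φ).homEquiv _ _).injective
  rw [Adjunction.homEquiv_unit, Adjunction.homEquiv_unit]
  exact pull_hom_ext ψ h

/-- The identification of `g_* f_* N` with `(f ≫ g)_* N`. -/
def pushToComp (N : Modules A) : (push ψ).obj ((push φ).obj N) ⟶ (push θ).obj N :=
  mkHom (fun O =>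
    { toFun := fun x => (pushSec θ N O).symm (pushSec φ N _ (pushSec ψ _ O x))
      map_add' := fun _ _ => rfl
      map_smul' := fun a x => congrArg
        (fun r : Fn A ((Opens.map f).obj ((Opens.map g).obj O)) =>
          r • pushSec φ N _ (pushSec ψ _ O x)) (hθ O a).symm })
    (fun _ _ _ _ => rfl)

/-- The identification of `(f ≫ g)_* N` with `g_* f_* N`. -/
def pushOfComp (N : Modules A) : (push θ).obj N ⟶ (push ψ).obj ((push φ).obj N) :=
  mkHom (fun O =>
    { toFun := fun x => (pushSec ψ _ O).symm ((pushSec φ N _).symm (pushSec θ N O x))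
      map_add' := fun _ _ => rfl
      map_smul' := fun a x => congrArg
        (fun r : Fn A ((Opens.map f).obj ((Opens.map g).obj O)) =>
          r • (show Sec N ((Opens.map f).obj ((Opens.map g).obj O)) from pushSec θ N O x))
        (hθ O a) })
    (fun _ _ _ _ => rfl)

/-- The canonical morphism `(f ≫ g)^* M ⟶ f^* g^* M`. -/
def compHom (M : Modules C) : (pull θ).obj M ⟶ (pull φ).obj ((pull ψ).obj M) :=
  ((adj θ).homEquiv _ _).symm ((adj ψ).unit.app M ≫ (push ψ).map ((adj φ).unit.app _) ≫
    pushToComp φ ψ θ hθ _)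

/-- The canonical morphism `f^* g^* M ⟶ (f ≫ g)^* M`. -/
def compInv (M : Modules C) : (pull φ).obj ((pull ψ).obj M) ⟶ (pull θ).obj M :=
  ((adj φ).homEquiv _ _).symm (((adj ψ).homEquiv _ _).symm ((adj θ).unit.app M ≫
    pushOfComp φ ψ θ hθ _))

lemma ap_compHom (M : Modules C) (O : Opens Z) (m : Sec M O) :
    ap (compHom φ ψ θ hθ M) _ (eta θ M O m) =
      eta φ _ ((Opens.map g).obj O) (eta ψ M O m) :=
  ap_lift_eta θ _ _ m

lemma ap_compInv (M : Modules C) (O : Opens Z) (m : Sec M O) :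
    ap (compInv φ ψ θ hθ M) _ (eta φ _ ((Opens.map g).obj O) (eta ψ M O m)) =
      eta θ M O m :=
  (ap_lift_eta φ _ _ (eta ψ M O m)).trans
    (congrArg (pushSec φ _ _) (ap_lift_eta ψ _ _ m))

/-- The isomorphism `(f ≫ g)^* ≅ f^* g^*` on a module, which identifies the section
`η m` of `(f ≫ g)^* M` with the section `η (η m)` of `f^* g^* M`. -/
def compIso (M : Modules C) : (pull θ).obj M ≅ (pull φ).obj ((pull ψ).obj M) where
  hom := compHom φ ψ θ hθ M
  inv := compInv φ ψ θ hθ M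
  hom_inv_id := by
    apply pull_hom_ext
    intro O m
    rw [ap_comp, ap_compHom, ap_id]
    exact ap_compInv φ ψ θ hθ M O m
  inv_hom_id := by
    apply pull_pull_hom_ext
    intro O m
    rw [ap_comp, ap_compInv, ap_id]
    exact ap_compHom φ ψ θ hθ M O m

lemma ap_compIso_hom (M : Modules C) (O : Opens Z) (m : Sec M O) :
    ap (compIso φ ψ θ hθ M).hom _ (eta θ M O m) =
      eta φ _ ((Opens.map g).obj O) (eta ψ M O m) :=
  ap_compHom φ ψ θ hθ M O m

lemma ap_compIso_inv (M : Modules C) (O : Opens Z) (m : Sec M O) :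
    ap (compIso φ ψ θ hθ M).inv _ (eta φ _ ((Opens.map g).obj O) (eta ψ M O m)) =
      eta θ M O m :=
  ap_compInv φ ψ θ hθ M O m

lemma compIso_naturality {M N : Modules C} (k : M ⟶ N) :
    (pull θ).map k ≫ (compIso φ ψ θ hθ N).hom =
      (compIso φ ψ θ hθ M).hom ≫ (pull φ).map ((pull ψ).map k) := by
  apply pull_hom_ext θ
  intro O m
  rw [ap_comp, ap_comp, ap_map_eta, ap_compIso_hom, ap_compIso_hom]
  refine Eq.trans ?_
    (ap_map_eta φ ((pull ψ).map k) ((Opens.map g).obj O) (eta ψ M O m)).symm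
  rw [ap_map_eta]

lemma compIso_pullPairing {M : Modules C} (τ : tens M M ⟶ unitM C) :
    tensMap (compIso φ ψ θ hθ M).hom (compIso φ ψ θ hθ M).hom ≫
      pullPairing φ (pullPairing ψ τ) = pullPairing θ τ := by
  apply pullTens_ext θ
  intro O m n
  rw [ap_comp, ap_tensMap, ap_compIso_hom, ap_compIso_hom, ap_pullPairing]
  refine (ap_pullPairing φ (pullPairing ψ τ) ((Opens.map g).obj O)
    (eta ψ _ O m) (eta ψ _ O n)).trans ?_
  rw [ap_pullPairing]
  exact (hθ O _).symm

end comp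

section id
variable (ε : RingMap (𝟙 X) A A) (hε : ∀ (O : Opens X) (a : Fn A O), co ε O a = a)

/-- The identification of `id_* N` with `N`. -/
def pushToId (N : Modules A) : (push ε).obj N ⟶ N :=
  mkHom (fun O =>
    { toFun := fun x => pushSec ε N O x
      map_add' := fun _ _ => rfl
      map_smul' := fun a x => congrArg (fun r : Fn A O =>
        r • (show Sec N O from pushSec ε N O x)) (hε O a) })
    (fun _ _ _ _ => rfl)

/-- The identification of `N` with `id_* N`. -/
def pushOfId (N : Modules A) : N ⟶ (push ε).obj N :=
  mkHom (fun O =>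
    { toFun := fun x => (pushSec ε N O).symm x
      map_add' := fun _ _ => rfl
      map_smul' := fun a x => congrArg (fun r : Fn A O => r • x) (hε O a).symm })
    (fun _ _ _ _ => rfl)

/-- The canonical morphism `id^* M ⟶ M`. -/
def idHom (M : Modules A) : (pull ε).obj M ⟶ M :=
  ((adj ε).homEquiv _ _).symm (pushOfId ε hε M)

lemma ap_idHom (M : Modules A) (O : Opens X) (m : Sec M O) :
    ap (idHom ε hε M) ((Opens.map (𝟙 X)).obj O) (eta ε M O m) = m :=
  ap_lift_eta ε _ _ m

/-- The canonical morphism `M ⟶ id^* M`. -/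
def idInv (M : Modules A) : M ⟶ (pull ε).obj M :=
  (adj ε).unit.app M ≫ pushToId ε hε _

lemma ap_idInv (M : Modules A) (O : Opens X) (m : Sec M O) :
    ap (idInv ε hε M) O m = eta ε M O m := rfl

/-- The isomorphism `id^* M ≅ M`, which identifies the section `η m` with `m`. -/
def idIso (M : Modules A) : (pull ε).obj M ≅ M where
  hom := idHom ε hε M
  inv := idInv ε hε M
  hom_inv_id := by
    apply pull_hom_ext
    intro O m
    rw [ap_comp, ap_idHom, ap_id]
    exact ap_idInv ε hε M O m
  inv_hom_id := ap_ext fun O m => ap_idHom ε hε M O m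

lemma ap_idIso_hom (M : Modules A) (O : Opens X) (m : Sec M O) :
    ap (idIso ε hε M).hom ((Opens.map (𝟙 X)).obj O) (eta ε M O m) = m :=
  ap_idHom ε hε M O m

lemma idIso_naturality {M N : Modules A} (k : M ⟶ N) :
    (pull ε).map k ≫ (idIso ε hε N).hom = (idIso ε hε M).hom ≫ k := by
  apply pull_hom_ext ε
  intro O m
  rw [ap_comp, ap_comp, ap_map_eta, ap_idIso_hom, ap_idIso_hom]
  rfl

lemma idIso_pullPairing {M : Modules A} (τ : tens M M ⟶ unitM A) :
    tensMap (idIso ε hε M).hom (idIso ε hε M).hom ≫ τ = pullPairing ε τ := by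
  apply pullTens_ext ε
  intro O m n
  rw [ap_comp, ap_tensMap, ap_idIso_hom, ap_idIso_hom, ap_pullPairing]
  exact (hε O _).symm

end id

namespace PoissonModule

/-- The isomorphism `(f ≫ g)^* ≅ f^* g^*` of functors between categories of Poisson modules. -/
def pullbackComp {g : Y ⟶ Z} {C : TopCat.Sheaf CommRingCat.{u} Z} (ψ : RingMap g B C)
    (θ : RingMap (f ≫ g) A C)
    (hθ : ∀ (O : Opens Z) (a : Fn C O), co θ O a = co φ ((Opens.map g).obj O) (co ψ O a)) :
    pullback θ ≅ pullback ψ ⋙ pullback φ :=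
  NatIso.ofComponents
    (fun V => isoMk (compIso φ ψ θ hθ V.module) (compIso_pullPairing φ ψ θ hθ V.pairing))
    (fun k => hom_ext (compIso_naturality φ ψ θ hθ k.hom))

/-- The isomorphism `id^* ≅ id` of functors between categories of Poisson modules. -/
def pullbackId (ε : RingMap (𝟙 X) A A) (hε : ∀ (O : Opens X) (a : Fn A O), co ε O a = a) :
    pullback ε ≅ 𝟭 (PoissonModule A) :=
  NatIso.ofComponents
    (fun V => isoMk (idIso ε hε V.module) (idIso_pullPairing ε hε V.pairing))
    (fun k => hom_ext (idIso_naturality ε hε k.hom))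

end PoissonModule

section coherence
variable {g : Y ⟶ Z} {C : TopCat.Sheaf CommRingCat.{u} Z} (ψ : RingMap g B C)

lemma ap_comp_id (ε : RingMap (𝟙 Y) B B) (hε : ∀ (O : Opens Y) (a : Fn B O), co ε O a = a)
    (θ : RingMap (f ≫ 𝟙 Y) A B)
    (hθ : ∀ (O : Opens Y) (a : Fn B O), co θ O a = co φ ((Opens.map (𝟙 Y)).obj O) (co ε O a))
    (M : Modules B) (O : Opens Y) (m : Sec M O) :
    ap ((compIso φ ε θ hθ M).hom ≫ (pull φ).map (idIso ε hε M).hom) _ (eta θ M O m) =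
      eta φ M O m := by
  rw [ap_comp, ap_compIso_hom]
  refine (ap_map_eta φ (idIso ε hε M).hom ((Opens.map (𝟙 Y)).obj O) (eta ε M O m)).trans ?_
  rw [ap_idIso_hom]
  rfl

lemma ap_id_comp (ε : RingMap (𝟙 X) A A) (hε : ∀ (O : Opens X) (a : Fn A O), co ε O a = a)
    (θ : RingMap (𝟙 X ≫ f) A B)
    (hθ : ∀ (O : Opens Y) (a : Fn B O), co θ O a = co ε ((Opens.map f).obj O) (co φ O a))
    (M : Modules B) (O : Opens Y) (m : Sec M O) :
    ap ((compIso ε φ θ hθ M).hom ≫ (idIso ε hε ((pull φ).obj M)).hom) _ (eta θ M O m) =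
      eta φ M O m := by
  rw [ap_comp, ap_compIso_hom]
  exact ap_idIso_hom ε hε ((pull φ).obj M) ((Opens.map f).obj O) (eta φ M O m)

lemma ap_assoc {T : TopCat.{u}} {h : Z ⟶ T} {D : TopCat.Sheaf CommRingCat.{u} T} (χ : RingMap h C D)
    (φψ : RingMap (f ≫ g) A C)
    (h₁ : ∀ (O : Opens Z) (a : Fn C O), co φψ O a = co φ ((Opens.map g).obj O) (co ψ O a))
    (ψχ : RingMap (g ≫ h) B D)
    (h₂ : ∀ (O : Opens T) (a : Fn D O), co ψχ O a = co ψ ((Opens.map h).obj O) (co χ O a))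
    (θ : RingMap (f ≫ g ≫ h) A D)
    (h₃ : ∀ (O : Opens T) (a : Fn D O), co θ O a = co φ ((Opens.map (g ≫ h)).obj O) (co ψχ O a))
    (θ' : RingMap ((f ≫ g) ≫ h) A D)
    (h₄ : ∀ (O : Opens T) (a : Fn D O), co θ' O a = co φψ ((Opens.map h).obj O) (co χ O a))
    (M : Modules D) (O : Opens T) (m : Sec M O) :
    ap ((compIso φ ψχ θ h₃ M).hom ≫ (pull φ).map (compIso ψ χ ψχ h₂ M).hom ≫
        (compIso φ ψ φψ h₁ ((pull χ).obj M)).inv ≫ (compIso φψ χ θ' h₄ M).inv) _ (eta θ M O m) =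
      eta θ' M O m := by
  rw [ap_comp, ap_comp, ap_comp, ap_compIso_hom]
  refine (congrArg (fun x => ap (compIso φψ χ θ' h₄ M).inv _
    (ap (compIso φ ψ φψ h₁ ((pull χ).obj M)).inv _ x))
    (ap_map_eta φ (compIso ψ χ ψχ h₂ M).hom ((Opens.map (g ≫ h)).obj O) (eta ψχ M O m))).trans ?_
  rw [ap_compIso_hom]
  refine (congrArg (fun x => ap (compIso φψ χ θ' h₄ M).inv _ x)
    (ap_compIso_inv φ ψ φψ h₁ _ ((Opens.map h).obj O) (eta χ M O m))).trans ?_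
  exact ap_compIso_inv φψ χ θ' h₄ M O m

end coherence

end

noncomputable section

/- Smooth manifolds. -/

open scoped Manifold ContDiff

/-- A smooth manifold: finite-dimensional, Hausdorff, second countable, without boundary. -/
structure SmoothMan where
  dim : ℕ
  carrier : Type
  [topologicalSpace : TopologicalSpace carrier]
  [chartedSpace : ChartedSpace (EuclideanSpace ℝ (Fin dim)) carrier]
  [isManifold : IsManifold (𝓡 dim) ∞ carrier]
  [t2Space : T2Space carrier]
  [secondCountableTopology : SecondCountableTopology carrier]

namespace SmoothMan

attribute [instance] topologicalSpace chartedSpace isManifold t2Space secondCountableTopology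

/-- Morphisms are smooth maps. -/
instance : Category SmoothMan where
  Hom U V := C^∞⟮𝓡 U.dim, U.carrier; 𝓡 V.dim, V.carrier⟯
  id U := ContMDiffMap.id
  comp f g := ContMDiffMap.comp g f

variable {U V W : SmoothMan}

/-- The underlying map of a smooth map. -/
def toFun (h : U ⟶ V) : U.carrier → V.carrier := h.1

lemma contMDiff_toFun (h : U ⟶ V) : ContMDiff (𝓡 U.dim) (𝓡 V.dim) ∞ (toFun h) := h.2

/-- A smooth map as a morphism. -/
def ofFun (h : U.carrier → V.carrier) (hh : ContMDiff (𝓡 U.dim) (𝓡 V.dim) ∞ h) : U ⟶ V := ⟨h, hh⟩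

lemma hom_ext {h k : U ⟶ V} (e : ∀ x, toFun h x = toFun k x) : h = k :=
  Subtype.ext (funext e)

/-- The underlying continuous map of a smooth map. -/
def cont (h : U ⟶ V) : TopCat.of U.carrier ⟶ TopCat.of V.carrier :=
  TopCat.ofHom ⟨toFun h, (contMDiff_toFun h).continuous⟩

/-- The sheaf of smooth real-valued functions on a smooth manifold. -/
def smoothFn (U : SmoothMan) : TopCat.Sheaf CommRingCat.{0} (TopCat.of U.carrier) :=
  smoothSheafCommRing (𝓡 U.dim) 𝓘(ℝ) U.carrier ℝ

/-- Precomposition of smooth functions with a smooth map. -/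
def comap (h : U ⟶ V) : RingMap (cont h) (smoothFn U) (smoothFn V) :=
  ⟨Functor.whiskerRight
    (ContMDiff.smoothSheafCommRingHom (𝓡 V.dim) V.carrier
      (toFun h) (contMDiff_toFun h)).hom (forget₂ CommRingCat.{0} RingCat.{0})⟩

lemma co_comap_id (O : Opens U.carrier) (a : Fn (smoothFn U) O) :
   co (comap (𝟙 U)) O a = a := rfl

lemma co_comap_comp (h : U ⟶ V) (k : V ⟶ W) (O : Opens W.carrier) (a : Fn (smoothFn W) O) :
   co (comap (h ≫ k)) O a = co (comap h) _ (co (comap k) O a) := rfl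

/-- The functor `h^*` for a smooth map `h`. -/
def pb (h : U ⟶ V) : PoissonModule (smoothFn V) ⥤ PoissonModule (smoothFn U) :=
  PoissonModule.pullback (comap h)

/-- The coherence isomorphism `id^* ≅ id`. -/
def pbId (U : SmoothMan) : pb (𝟙 U) ≅ 𝟭 (PoissonModule (smoothFn U)) :=
  PoissonModule.pullbackId (comap (𝟙 U)) co_comap_id

/-- The coherence isomorphism `(h ≫ k)^* ≅ h^* k^*`. -/
def pbComp (h : U ⟶ V) (k : V ⟶ W) : pb (h ≫ k) ≅ pb k ⋙ pb h :=
  PoissonModule.pullbackComp (comap h) (comap k) (comap (h ≫ k)) (co_comap_comp h k)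

lemma pb_comp_id (h : U ⟶ V) (M : PoissonModule (smoothFn V)) :
    (pbComp h (𝟙 V)).hom.app M ≫ (pb h).map ((pbId V).hom.app M) = 𝟙 ((pb h).obj M) :=
  PoissonModule.hom_ext (pull_hom_ext (comap h) fun O m =>
    ap_comp_id (comap h) (comap (𝟙 V)) co_comap_id (comap (h ≫ 𝟙 V)) (co_comap_comp h (𝟙 V))
      M.module O m)

lemma pb_id_comp (h : U ⟶ V) (M : PoissonModule (smoothFn V)) :
    (pbComp (𝟙 U) h).hom.app M ≫ (pbId U).hom.app ((pb h).obj M) = 𝟙 ((pb h).obj M) :=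
  PoissonModule.hom_ext (pull_hom_ext (comap h) fun O m =>
    ap_id_comp (comap h) (comap (𝟙 U)) co_comap_id (comap (𝟙 U ≫ h)) (co_comap_comp (𝟙 U) h)
      M.module O m)

lemma pb_assoc (h : U ⟶ V) (k : V ⟶ W) {T : SmoothMan} (l : W ⟶ T)
    (M : PoissonModule (smoothFn T)) :
    (pbComp h (k ≫ l)).hom.app M ≫ (pb h).map ((pbComp k l).hom.app M) ≫
      (pbComp h k).inv.app ((pb l).obj M) ≫ (pbComp (h ≫ k) l).inv.app M =
        𝟙 ((pb (h ≫ k ≫ l)).obj M) :=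
  PoissonModule.hom_ext (pull_hom_ext (comap (h ≫ k ≫ l)) fun O m =>
    ap_assoc (comap h) (comap k) (comap l) (comap (h ≫ k)) (co_comap_comp h k)
      (comap (k ≫ l)) (co_comap_comp k l) (comap (h ≫ k ≫ l)) (co_comap_comp h (k ≫ l))
      (comap ((h ≫ k) ≫ l)) (co_comap_comp (h ≫ k) l) M.module O m)

end SmoothMan

open SmoothMan in
/-- The prestack `PoVec_ℝ^∞`. It sends a manifold `U` to the category of sheaves of modules `W` over
the sheaf of smooth functions with an antisymmetric pairing `W ⊗ W ⟶ C^∞`, and a smooth map `h` to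
the inverse image functor `h^*`. -/
def PoVecInfty : Pseudofunctor (LocallyDiscrete SmoothManᵒᵖ) Cat.{0, 1} :=
  LocallyDiscrete.mkPseudofunctor
    (fun U => Cat.of (PoissonModule (smoothFn U.unop)))
    (fun h => (pb h.unop).toCatHom)
    (fun U => Cat.Hom.isoMk (pbId U.unop))
    (fun h k => Cat.Hom.isoMk (pbComp k.unop h.unop))
    (fun h k l => Cat.Hom₂.ext (NatTrans.ext (funext fun M => by
      refine Eq.trans ?_ ((pb_assoc l.unop k.unop h.unop M).trans ?_)
      · exact congrArg (fun x => (pbComp l.unop (k.unop ≫ h.unop)).hom.app M ≫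
          (pb l.unop).map ((pbComp k.unop h.unop).hom.app M) ≫ x) (Category.id_comp _)
      · rw [Cat.eqToHom_app]; rfl)))
    (fun {U V} h => Cat.Hom₂.ext (NatTrans.ext (funext fun M => by
      refine Eq.trans ?_ ((pb_comp_id h.unop M).trans ?_)
      · exact congrArg (fun x => (pbComp h.unop (𝟙 U.unop)).hom.app M ≫ x) (Category.comp_id _)
      · rw [Cat.eqToHom_app]; rfl)))
    (fun {U V} h => Cat.Hom₂.ext (NatTrans.ext (funext fun M => by
      refine Eq.trans ?_ ((pb_id_comp h.unop M).trans ?_)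
      · exact congrArg (fun x => (pbComp (𝟙 V.unop) h.unop).hom.app M ≫ x) (Category.comp_id _)
      · rw [Cat.eqToHom_app]; rfl)))

/- Descent. -/

namespace SmoothMan

/-- An open subset of a smooth manifold, as a smooth manifold. -/
def openSub {U : SmoothMan} (O : Opens U.carrier) : SmoothMan where
  dim := U.dim
  carrier := O

variable {U : SmoothMan}

/-- The inclusion of an open subset. -/
def ofOpen (O : Opens U.carrier) : openSub O ⟶ U :=
  ofFun (U := openSub O) (fun x : O => x.1) (contMDiff_subtype_val (I := 𝓡 U.dim) (U := O))

/-- The inclusion of an open subset into a larger one. -/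
def ofLE {O O' : Opens U.carrier} (h : O ≤ O') : openSub O ⟶ openSub O' :=
  ofFun (U := openSub O) (V := openSub O') (Set.inclusion h)
    (contMDiff_inclusion (I := 𝓡 U.dim) h)

/-- A smooth map with values in an open subset. -/
def lift {O : Opens U.carrier} {T : SmoothMan} (k : T ⟶ U) (hk : ∀ t, toFun k t ∈ O) :
    T ⟶ openSub O :=
  ofFun (V := openSub O) (fun t => (⟨toFun k t, hk t⟩ : O))
    ((ContMDiff.subtypeVal_comp_iff (I := 𝓡 T.dim) (I' := 𝓡 U.dim) O _).1 (contMDiff_toFun k))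

lemma ofLE_ofOpen {O O' : Opens U.carrier} (h : O ≤ O') : ofLE h ≫ ofOpen O' = ofOpen O := rfl

lemma ofOpen_injective (O : Opens U.carrier) : Function.Injective (toFun (ofOpen O)) :=
  Subtype.val_injective

lemma mono_ofOpen {O : Opens U.carrier} {T : SmoothMan} {a b : T ⟶ openSub O}
    (h : a ≫ ofOpen O = b ≫ ofOpen O) : a = b :=
  hom_ext fun x => ofOpen_injective O congr(toFun $h x)

lemma lift_ofOpen {O : Opens U.carrier} {T : SmoothMan} (k : T ⟶ U) (hk : ∀ t, toFun k t ∈ O) :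
    lift k hk ≫ ofOpen O = k := rfl

/-- The intersection `D` of two open subsets `A` and `B` of a manifold is a fibre product. -/
def interIsLimit {S : SmoothMan} {A B D : Opens U.carrier} (hA : D ≤ A) (hB : D ≤ B)
    (hD : A ⊓ B ≤ D) (a : openSub A ⟶ S) (b : openSub B ⟶ S) (s : S ⟶ U) (ha : a ≫ s = ofOpen A)
    (hb : b ≫ s = ofOpen B) (w : ofLE hA ≫ a = ofLE hB ≫ b) :
    IsLimit (PullbackCone.mk (ofLE hA) (ofLE hB) w) :=
  PullbackCone.IsLimit.mk w
    (fun c => lift (c.fst ≫ ofOpen A) fun t => hD ⟨(toFun c.fst t : A).2, by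
      have h : c.fst ≫ ofOpen A = c.snd ≫ ofOpen B := by
        rw [← ha, ← hb, c.condition_assoc]
      have h' : toFun (c.fst ≫ ofOpen A) t = toFun (c.snd ≫ ofOpen B) t := by rw [h]
      change toFun (c.fst ≫ ofOpen A) t ∈ B
      rw [h']
      exact (toFun c.snd t : B).2⟩)
    (fun c => mono_ofOpen rfl)
    (fun c => mono_ofOpen (by
      refine Eq.trans (b := c.fst ≫ ofOpen A) rfl ?_
      rw [← ha, ← hb, c.condition_assoc]))
    (fun c m h _ => mono_ofOpen (by
      refine Eq.trans ?_ (congrArg (fun x => x ≫ ofOpen A) h)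
      rfl))

variable {ι : Type} (V : ι → Opens U.carrier)

/-- The fibre products `V i ×_U V j = V i ∩ V j`. -/
def inter₂ (i j : ι) : ChosenPullback (ofOpen (V i)) (ofOpen (V j)) where
  pullback := openSub (V i ⊓ V j)
  p₁ := ofLE inf_le_left
  p₂ := ofLE inf_le_right
  condition := rfl
  isLimit := interIsLimit inf_le_left inf_le_right le_rfl (ofOpen (V i)) (ofOpen (V j)) (𝟙 U)
    rfl rfl rfl
  p := ofOpen (V i ⊓ V j)
  hp₁ := rfl

/-- The fibre product of `V i ∩ V j` and `V j ∩ V k` over `V j` is `V i ∩ V j ∩ V k`. -/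
def interInter (i j k : ι) : ChosenPullback (inter₂ V i j).p₂ (inter₂ V j k).p₁ where
  pullback := openSub (V i ⊓ V j ⊓ V k)
  p₁ := ofLE inf_le_left
  p₂ := ofLE (le_inf (inf_le_left.trans inf_le_right) inf_le_right)
  condition := rfl
  isLimit := interIsLimit (S := openSub (V j)) (A := V i ⊓ V j) (B := V j ⊓ V k)
    inf_le_left (le_inf (inf_le_left.trans inf_le_right) inf_le_right)
    (le_inf inf_le_left (inf_le_right.trans inf_le_right)) (inter₂ V i j).p₂
    (inter₂ V j k).p₁ (ofOpen (V j)) rfl rfl rfl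
  p := ofLE (inf_le_left.trans inf_le_right)
  hp₁ := rfl

/-- The threefold fibre products `V i ∩ V j ∩ V k`. -/
def inter₃ (i j k : ι) : ChosenPullback₃ (inter₂ V i j) (inter₂ V j k) (inter₂ V i k) where
  chosenPullback := interInter V i j k
  p := ofOpen (V i ⊓ V j ⊓ V k)
  p₁ := ofLE (inf_le_left.trans inf_le_left)
  p₃ := ofLE inf_le_right
  l :=
    { f := ofLE (le_inf (inf_le_left.trans inf_le_left) inf_le_right)
      f_p₁ := rfl
      f_p₂ := rfl
      f_p := rfl }
  hp₁ := rfl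
  hp₃ := rfl

end SmoothMan

open SmoothMan in
/-- The canonical functor from `F(U)` to the descent category of a family of open subsets `V i` of `U`.
An object of the descent category consists of objects `x i` of `F(V i)` and morphisms
`φ i j : x i |_{V i ∩ V j} ⟶ x j |_{V i ∩ V j}`, such that `φ i i` becomes the identity on `V i` and
`φ j k ∘ φ i j = φ i k` on `V i ∩ V j ∩ V k`, up to the coherence isomorphisms of `F`; the `φ i j` are
then isomorphisms. -/
def toDescent (F : Pseudofunctor (LocallyDiscrete SmoothManᵒᵖ) Cat.{0, 1}) {U : SmoothMan}
    {ι : Type} (V : ι → Opens U.carrier) :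
    F.obj (.mk (op U)) ⥤ F.DescentData' (inter₂ V) (inter₃ V) :=
  F.toDescentData (fun i => ofOpen (V i)) ⋙
    Pseudofunctor.DescentData'.fromDescentDataFunctor F (inter₂ V) (inter₃ V)

/-- A prestack on the site of manifolds is a stack if it satisfies descent for all open covers. -/
def IsStack (F : Pseudofunctor (LocallyDiscrete SmoothManᵒᵖ) Cat.{0, 1}) : Prop :=
  ∀ (U : SmoothMan) (ι : Type) (V : ι → Opens U.carrier), iSup V = ⊤ →
    (toDescent F V).IsEquivalence

end

end SmoothStack

/-! Sheaves of modules, their morphisms and their pairings are all given by sections over small open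
sets, so they glue along an open cover. The geometric input is that the inverse image along an open
inclusion `f` with image `V` is restriction: the unit `M(O) → (f^* M)(f⁻¹ O)` is bijective for `O ≤
V` (`IsOpenImm.eta_bijective`). Statements about inverse images thereby become statements about
sections over open subsets of `U`.

Full faithfulness: local morphisms that agree on overlaps glue section by section
(`exists_glue_hom`). Compatibility with the pairings is an equality of functions, hence local.

Essential surjectivity: a descent datum `N i` gives transition maps between the sections of `N i`
and of `N j` over each `O ≤ V i ⊓ V j`. The glued sheaf has as sections the families of sections of
the direct images of the `N i` that are matched by these maps, and the cocycle condition makes its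
`i`-th projection bijective over subsets of `V i` (`GluingData.proj_bijective`). The transition maps
preserve the pairings, so the pairings agree on overlaps and glue as well
(`PoissonGluing.exists_bilin`).

The coherence isomorphisms enter only through their effect on sections that come from below, which
they match with one another. This is encoded by the relation `Corr`: `x` over `V i` and `y` over `V
j` correspond if the given morphism sends the image of `x` on `V i ⊓ V j` to the image of `y`. The
axioms of a descent datum say that `Corr` is reflexive and transitive (`corr_self`, `Corr.trans`),
and `Corr` determines the morphism (`corr_hom_ext`). -/

namespace SmoothStack

open CategoryTheory Opposite TopologicalSpace MonoidalCategory Limits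

noncomputable section
variable {X Y : TopCat.{u}} {A : TopCat.Sheaf CommRingCat.{u} X} {B : TopCat.Sheaf CommRingCat.{u} Y}

/-! ### Local nature of sections. -/

/-- Sections of a sheaf of modules that agree on intersections glue uniquely. -/
lemma existsUnique_section (M : Modules A) {ι : Type*} {O : Opens X} {Q : ι → Opens X}
    (hQ : ∀ i, Q i ≤ O) (hO : O ≤ iSup Q) (s : ∀ i, Sec M (Q i))
    (hs : ∀ i j, res M (inf_le_left : Q i ⊓ Q j ≤ Q i) (s i) = res M inf_le_right (s j)) :
    ∃! t : Sec M O, ∀ i, res M (hQ i) t = s i := by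
  let F : TopCat.Sheaf Ab.{u} X := ⟨M.val.presheaf, M.isSheaf⟩
  let s' (i) : ToType (F.1.obj (op (Q i))) := s i
  have hs' : TopCat.Presheaf.IsCompatible F.1 Q s' := hs
  exact F.existsUnique_gluing' Q O (fun i => homOfLE (hQ i)) hO s' hs'

/-- Sections of a sheaf of modules that agree locally are equal. -/
lemma section_ext (M : Modules A) {ι : Type*} {O : Opens X} {Q : ι → Opens X}
    (hQ : ∀ i, Q i ≤ O) (hO : O ≤ iSup Q) {s t : Sec M O}
    (h : ∀ i, res M (hQ i) s = res M (hQ i) t) : s = t :=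
  TopCat.Sheaf.eq_of_locally_eq' (⟨M.val.presheaf, M.isSheaf⟩ : TopCat.Sheaf Ab.{u} X)
    Q O (fun i => homOfLE (hQ i)) hO s t h

/-- The open sets are equal, often only propositionally; two inclusions replace transport along the
equality. -/
lemma res_bijective (M : Modules A) {O O' : Opens X} (h : O ≤ O') (h' : O' ≤ O) :
    Function.Bijective (res M h) :=
  Function.bijective_iff_has_inverse.2 ⟨res M h', fun x => by rw [res_res, res_self],
    fun x => by rw [res_res, res_self]⟩

/-- A morphism of sheaves of modules that is bijective on sections is an isomorphism. -/
def isoOfBijective {M N : Modules A} (g : M ⟶ N) (hg : ∀ O, Function.Bijective (ap g O)) :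
    M ≅ N where
  hom := g
  inv := mkHom (fun O => (LinearEquiv.ofBijective (ap g O) (hg O)).symm.toLinearMap)
    (fun O O' h x => by
      apply (hg O).1
      rw [ap_res]
      exact ((LinearEquiv.ofBijective (ap g O) (hg O)).apply_symm_apply _).trans
        (congrArg (res N h) ((LinearEquiv.ofBijective (ap g O') (hg O')).apply_symm_apply x).symm))
  hom_inv_id := ap_ext fun O x => (LinearEquiv.ofBijective (ap g O) (hg O)).symm_apply_apply x
  inv_hom_id := ap_ext fun O x => (LinearEquiv.ofBijective (ap g O) (hg O)).apply_symm_apply x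

/-! ### Inverse images along open immersions. -/

/-- A morphism `φ` of ringed spaces is an open immersion with image `V`. -/
structure IsOpenImm {f : X ⟶ Y} (φ : RingMap f A B) (V : Opens Y) : Prop where
  isOpenEmbedding : Topology.IsOpenEmbedding f
  range_eq : Set.range f = V
  bijective : ∀ O ≤ V, Function.Bijective (co φ O)

namespace IsOpenImm

variable {f : X ⟶ Y} {φ : RingMap f A B} {V : Opens Y} (hφ : IsOpenImm φ V)

/-- Every point of `O` has the form `f x`, so preimages detect it. -/
lemma injOn_map (hφ : IsOpenImm φ V) {O : Opens Y} (hO : O ≤ V) {O' : Opens Y}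
    (h : (Opens.map f).obj O ≤ (Opens.map f).obj O') : O ≤ O' := by
  intro y hy
  obtain ⟨x, rfl⟩ : y ∈ Set.range f := by rw [hφ.range_eq]; exact hO hy
  exact h hy

/-- The image of an open set. -/
def im (O : Opens X) : Opens Y := hφ.isOpenEmbedding.functor.obj O

lemma im_le (O : Opens X) : hφ.im O ≤ V := by
  rintro _ ⟨x, -, rfl⟩
  change f x ∈ (V : Set Y)
  rw [← hφ.range_eq]
  exact ⟨x, rfl⟩

lemma map_im (O : Opens X) : (Opens.map f).obj (hφ.im O) = O :=
  Opens.map_functor_eq' f hφ.isOpenEmbedding O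

lemma im_map_le (O : Opens Y) : hφ.im ((Opens.map f).obj O) ≤ O := by
  rintro _ ⟨x, hx, rfl⟩
  exact hx

lemma le_im_map {O : Opens Y} (hO : O ≤ V) : O ≤ hφ.im ((Opens.map f).obj O) :=
  hφ.injOn_map hO (hφ.map_im _).ge

lemma im_mono {O O' : Opens X} (h : O ≤ O') : hφ.im O ≤ hφ.im O' :=
  (hφ.isOpenEmbedding.functor.map (homOfLE h)).le

/-- The isomorphism `B(O) ≅ A(f⁻¹ O)` for `O ≤ V`. -/
def coEquiv {O : Opens Y} (hO : O ≤ V) : Fn B O ≃+* Fn A ((Opens.map f).obj O) :=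
  RingEquiv.ofBijective (co φ O) (hφ.bijective O hO)

/-- The isomorphism `A(O) ≅ B(f O)`. -/
def coInv (O : Opens X) : Fn A O →+* Fn B (hφ.im O) :=
  (hφ.coEquiv (hφ.im_le O)).symm.toRingHom.comp (resRing A (hφ.map_im O).le)

lemma co_coInv (O : Opens X) (a : Fn A O) :
    co φ (hφ.im O) (hφ.coInv O a) = resRing A (hφ.map_im O).le a :=
  (hφ.coEquiv (hφ.im_le O)).apply_symm_apply _

lemma coInv_res {O O' : Opens X} (h : O ≤ O') (a : Fn A O') :
    hφ.coInv O (resRing A h a) = resRing B (hφ.im_mono h) (hφ.coInv O' a) := by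
  apply (hφ.bijective _ (hφ.im_le O)).1
  rw [co_coInv, co_res, co_coInv, resRing_resRing, resRing_resRing]

/-- This identity makes `restrUnit` linear over `B`. -/
lemma coInv_co (O : Opens Y) (a : Fn B O) :
    hφ.coInv ((Opens.map f).obj O) (co φ O a) = resRing B (hφ.im_map_le O) a := by
  apply (hφ.bijective _ (hφ.im_le _)).1
  rw [co_coInv, co_res]

/-- The isomorphisms `A(O) ≅ B(f O)` as a morphism of sheaves. -/
def coInvHom : haveI := hφ.isOpenEmbedding.functor_isContinuous
    ringSheaf A ⟶ (hφ.isOpenEmbedding.functor.sheafPushforwardContinuous RingCat.{u}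
      (Opens.grothendieckTopology X) (Opens.grothendieckTopology Y)).obj (ringSheaf B) :=
  haveI := hφ.isOpenEmbedding.functor_isContinuous
  ⟨{ app := fun O => RingCat.ofHom (hφ.coInv O.unop)
     naturality := fun O O' i => by
      ext a
      exact hφ.coInv_res i.unop.le a }⟩

/-- The sheaf of modules `O ↦ M(f O)`. -/
def restr (M : Modules B) : Modules A :=
  haveI := hφ.isOpenEmbedding.functor_isContinuous
  (SheafOfModules.pushforward.{u} hφ.coInvHom).obj M

/-- Sections of `restr M`. -/
def restrSec (M : Modules B) (O : Opens X) : Sec (hφ.restr M) O ≃+ Sec M (hφ.im O) :=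
  AddEquiv.refl _

lemma restrSec_smul (M : Modules B) (O : Opens X) (a : Fn A O) (x) :
    hφ.restrSec M O (a • x) = hφ.coInv O a • hφ.restrSec M O x := rfl

lemma restrSec_res (M : Modules B) {O O' : Opens X} (h : O ≤ O') (x) :
    hφ.restrSec M O (res _ h x) = res M (hφ.im_mono h) (hφ.restrSec M O' x) := rfl

/-- The restriction maps `M(O) → M(f f⁻¹ O)`. -/
def restrUnit (M : Modules B) : M ⟶ (push φ).obj (hφ.restr M) :=
  mkHom (fun O =>
    { toFun := fun x => (pushSec φ _ O).symm ((hφ.restrSec M _).symm (res M (hφ.im_map_le O) x))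
      map_add' := fun x y => res_add _ x y
      map_smul' := fun a x => (res_smul (hφ.im_map_le O) a x).trans
        (congrArg (fun r : Fn B (hφ.im ((Opens.map f).obj O)) => r • res M (hφ.im_map_le O) x)
          (hφ.coInv_co O a).symm) })
    (fun _ O' h x => (res_res (M := M) _ _ x).trans (res_res (M := M)
      (hφ.im_mono ((Opens.map f).map (homOfLE h)).le) (hφ.im_map_le O') x).symm)

/-- The morphism `f^* M ⟶ restr M`. -/
def pullToRestr (M : Modules B) : (pull φ).obj M ⟶ hφ.restr M :=
  ((adj φ).homEquiv _ _).symm (hφ.restrUnit M)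

lemma ap_pullToRestr (M : Modules B) (O : Opens Y) (x : Sec M O) :
    hφ.restrSec M _ (ap (hφ.pullToRestr M) _ (eta φ M O x)) = res M (hφ.im_map_le O) x :=
  congrArg (hφ.restrSec M _) (ap_lift_eta φ (hφ.restrUnit M) O x)

/-- The morphism `restr M ⟶ f^* M`. -/
def restrToPull (M : Modules B) : hφ.restr M ⟶ (pull φ).obj M :=
  mkHom (fun O =>
    { toFun := fun x => res _ (hφ.map_im O).ge (eta φ M _ (hφ.restrSec M O x))
      map_add' := fun x y => by rw [map_add, eta_add, res_add]
      map_smul' := fun a x => by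
        rw [restrSec_smul, eta_smul, res_smul, co_coInv, resRing_resRing]
        exact congrArg (fun r : Fn A O => r • _) congr($((ringSheaf A).obj.map_id _) a) })
    (fun O O' h x => by
      change res _ _ (eta φ M _ (hφ.restrSec M O (res _ h x))) =
        res _ _ (res _ _ (eta φ M _ (hφ.restrSec M O' x)))
      rw [restrSec_res, eta_res, res_res, res_res])

lemma ap_restrToPull (M : Modules B) (O : Opens X) (x) :
    ap (hφ.restrToPull M) O x = res _ (hφ.map_im O).ge (eta φ M _ (hφ.restrSec M O x)) := rfl

/-- The inverse image along an open immersion is the restriction. -/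
def pullIsoRestr (M : Modules B) : (pull φ).obj M ≅ hφ.restr M where
  hom := hφ.pullToRestr M
  inv := hφ.restrToPull M
  hom_inv_id := by
    apply pull_hom_ext
    intro O m
    rw [ap_comp, ap_restrToPull, ap_pullToRestr, eta_res, res_res, res_self, ap_id]
  inv_hom_id := by
    apply ap_ext
    intro O x
    apply (hφ.restrSec M O).injective
    rw [ap_comp, ap_restrToPull, ap_res, restrSec_res, ap_pullToRestr, res_res, res_self, ap_id]

/-- Followed by the isomorphism `f^* M ≅ restr M`, the map `eta` becomes the restriction `M(O) → M(f
f⁻¹ O)`, and `f f⁻¹ O = O` because `O` lies in the image of `f`. -/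
lemma eta_bijective (hφ : IsOpenImm φ V) (M : Modules B) {O : Opens Y} (hO : O ≤ V) :
    Function.Bijective (eta φ M O) := by
  have h : Function.Bijective (ap (hφ.pullToRestr M) ((Opens.map f).obj O)) :=
    Function.bijective_iff_has_inverse.2 ⟨ap (hφ.restrToPull M) _,
      fun x => congr(ap $((hφ.pullIsoRestr M).hom_inv_id) _ x),
      fun x => congr(ap $((hφ.pullIsoRestr M).inv_hom_id) _ x)⟩
  have h' : Function.Bijective (fun x => hφ.restrSec M _ (ap (hφ.pullToRestr M) _ (eta φ M O x))) := by
    simp only [ap_pullToRestr]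
    exact res_bijective M _ (hφ.le_im_map hO)
  exact (Function.Bijective.of_comp_iff' ((hφ.restrSec M _).bijective.comp h) _).1 h'

/-- The isomorphism `M(O) ≅ (f^* M)(f⁻¹ O)` for `O ≤ V`. -/
def etaEquiv (M : Modules B) {O : Opens Y} (hO : O ≤ V) :
    Sec M O ≃+ Sec ((pull φ).obj M) ((Opens.map f).obj O) :=
  AddEquiv.ofBijective (AddMonoidHom.mk' (eta φ M O) (eta_add φ M O)) (hφ.eta_bijective M hO)

lemma eta_symm (M : Modules B) {O : Opens Y} (hO : O ≤ V) (x) :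
    eta φ M O ((hφ.etaEquiv M hO).symm x) = x :=
  (hφ.etaEquiv M hO).apply_symm_apply x

/-- A morphism from an inverse image is an isomorphism if its adjoint is bijective on the open
subsets of the image of the open immersion. -/
lemma bijective_of_eta (hφ : IsOpenImm φ V) {M : Modules B} {N : Modules A} (g : (pull φ).obj M ⟶ N)
    (h : ∀ O ≤ V, Function.Bijective fun m => ap g _ (eta φ M O m)) (O : Opens X) :
    Function.Bijective (ap g O) := by
  -- Every open set of the source is the preimage of its image in `V`, and over that image the
  -- bijection `eta` can be cancelled.
  rw [← hφ.map_im O]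
  exact (Function.Bijective.of_comp_iff _ (hφ.eta_bijective M (hφ.im_le O))).1
    (h _ (hφ.im_le O))

end IsOpenImm

end

end SmoothStack

namespace SmoothStack

open CategoryTheory Opposite TopologicalSpace MonoidalCategory Limits

noncomputable section
variable {X : TopCat.{u}} {A : TopCat.Sheaf CommRingCat.{u} X}

/-! ### Gluing morphisms and bilinear maps. -/

section glueHom
variable {M N P : Modules A} {ι : Type*} {V : ι → Opens X}

lemma le_iSup_inf (hV : iSup V = ⊤) (O : Opens X) : O ≤ ⨆ i, V i ⊓ O := by
  rw [← iSup_inf_eq, hV, top_inf_eq]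

/-- Sections that agree on the intersections with the members of an open cover are equal. -/
lemma section_ext_cover (hV : iSup V = ⊤) {O : Opens X} {s t : Sec M O}
    (h : ∀ i, res M (inf_le_right : V i ⊓ O ≤ O) s = res M inf_le_right t) : s = t :=
  section_ext M (fun _ => inf_le_right) (le_iSup_inf hV O) h

/-- Morphisms defined on the members of an open cover glue if they agree on intersections. -/
lemma exists_glue_hom (hV : iSup V = ⊤) (g : ∀ i, M ⟶ loc N (V i))
    (hg : ∀ i j O (hi : O ≤ V i) (hj : O ≤ V j) (x : Sec M O),
      res N (le_inf hi le_rfl) (locSec N (V i) O (ap (g i) O x)) =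
        res N (le_inf hj le_rfl) (locSec N (V j) O (ap (g j) O x))) :
    ∃ k : M ⟶ N, ∀ i O (x : Sec M O),
      res N (inf_le_right : V i ⊓ O ≤ O) (ap k O x) = locSec N (V i) O (ap (g i) O x) := by
  -- For a fixed `x`, the images under the `g i` are sections over the `V i ⊓ O` that agree on
  -- overlaps by `hg`.
  have h (O : Opens X) (x : Sec M O) := existsUnique_section N (fun _ => inf_le_right)
    (le_iSup_inf hV O) (fun i => locSec N (V i) O (ap (g i) O x)) (fun i j => by
      have hO : V i ⊓ O ⊓ (V j ⊓ O) ≤ O := inf_le_left.trans inf_le_right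
      have := hg i j (V i ⊓ O ⊓ (V j ⊓ O)) (inf_le_left.trans inf_le_left)
        (inf_le_right.trans inf_le_left) (res M hO x)
      rw [ap_res, ap_res, locSec_res, locSec_res, res_res, res_res] at this
      exact this)
  choose k hk _ using h
  -- Linearity and naturality hold after restriction to each `V i ⊓ O`, where `k` is given by `g i`.
  refine ⟨mkHom (fun O =>
    { toFun := k O
      map_add' := fun x y => section_ext_cover hV fun i => by
        rw [res_add, hk, hk, hk, map_add, map_add]
      map_smul' := fun a x => section_ext_cover hV fun i => by
        rw [RingHom.id_apply, res_smul, hk, hk, map_smul, locSec_smul] })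
    (fun O O' h x => section_ext_cover hV fun i => ?_), fun i O x => hk O x i⟩
  change res N _ (k O (res M h x)) = res N _ (res N h (k O' x))
  rw [hk, ap_res, locSec_res, ← hk, res_res, res_res]

/-- Bilinear maps defined on the members of an open cover glue if they agree on intersections. -/
lemma exists_glue_bilin (hV : iSup V = ⊤) {M' N' : ι → Modules A} (p : ∀ i, M ⟶ M' i)
    (q : ∀ i, N ⟶ N' i) (b : ∀ i, Bilin (M' i) (N' i) (loc P (V i)))
    (hb : ∀ i j O (hi : O ≤ V i) (hj : O ≤ V j) (x : Sec M O) (y : Sec N O),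
      res P (le_inf hi le_rfl) (locSec P (V i) O ((b i).app O (ap (p i) O x) (ap (q i) O y))) =
        res P (le_inf hj le_rfl)
          (locSec P (V j) O ((b j).app O (ap (p j) O x) (ap (q j) O y)))) :
    ∃ c : Bilin M N P, ∀ i O (x : Sec M O) (y : Sec N O),
      res P (inf_le_right : V i ⊓ O ≤ O) (c.app O x y) =
        locSec P (V i) O ((b i).app O (ap (p i) O x) (ap (q i) O y)) := by
  -- The form `b i` lives on targets of `M` and `N`: in the application `M` and `N` are the glued
  -- sheaf and `p i`, `q i` its projections to the direct image from `V i`.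
  have h (O : Opens X) (x : Sec M O) (y : Sec N O) := existsUnique_section P
    (fun _ => inf_le_right) (le_iSup_inf hV O)
    (fun i => locSec P (V i) O ((b i).app O (ap (p i) O x) (ap (q i) O y))) (fun i j => by
      have hO : V i ⊓ O ⊓ (V j ⊓ O) ≤ O := inf_le_left.trans inf_le_right
      have := hb i j (V i ⊓ O ⊓ (V j ⊓ O)) (inf_le_left.trans inf_le_left)
        (inf_le_right.trans inf_le_left) (res M hO x) (res N hO y)
      rw [ap_res, ap_res, ap_res, ap_res, (b i).res_app, (b j).res_app, locSec_res, locSec_res,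
        res_res, res_res] at this
      exact this)
  choose c hc _ using h
  refine ⟨
    { app := c
      add_left := fun O x x' y => section_ext_cover hV fun i => by
        rw [res_add, hc, hc, hc, map_add, (b i).add_left, map_add]
      add_right := fun O x x' y => section_ext_cover hV fun i => by
        rw [res_add, hc, hc, hc, map_add, (b i).add_right, map_add]
      smul_left := fun O a x y => section_ext_cover hV fun i => by
        rw [res_smul, hc, hc, map_smul, (b i).smul_left, locSec_smul]
      smul_right := fun O a x y => section_ext_cover hV fun i => by
        rw [res_smul, hc, hc, map_smul, (b i).smul_right, locSec_smul]
      res_app := fun O O' h x y => section_ext_cover hV fun i => by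
        rw [hc, ap_res, ap_res, (b i).res_app, locSec_res, ← hc, res_res, res_res] },
    fun i O x y => hc O x y i⟩

end glueHom

/-! ### Gluing sheaves of modules. -/

/-- Gluing data for sheaves of modules: sheaves of modules that are direct images from the members
of a family of open subsets `V i`, with isomorphisms over the intersections that satisfy the
cocycle condition. -/
structure GluingData (A : TopCat.Sheaf CommRingCat.{u} X) {ι : Type u} (V : ι → Opens X) where
  module : ι → Modules A
  -- A direct image from `V i` does not distinguish `O` from `V i ⊓ O`; this is the only trace of
  -- being a direct image that is needed.
  res_bijective : ∀ i O, Function.Bijective (res (module i) (inf_le_right : V i ⊓ O ≤ O))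
  tr : ∀ i j O, O ≤ V i → O ≤ V j → (Sec (module i) O →ₗ[Fn A O] Sec (module j) O)
  tr_res : ∀ i j O O' (h : O ≤ O') (hi : O' ≤ V i) (hj : O' ≤ V j) x,
    tr i j O (h.trans hi) (h.trans hj) (res _ h x) = res _ h (tr i j O' hi hj x)
  tr_self : ∀ i O (hi : O ≤ V i) x, tr i i O hi hi x = x
  tr_tr : ∀ i j k O (hi : O ≤ V i) (hj : O ≤ V j) (hk : O ≤ V k) x,
    tr j k O hj hk (tr i j O hi hj x) = tr i k O hi hk x

namespace GluingData
variable {ι : Type u} {V : ι → Opens X} (D : GluingData A V)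

/-- Compatible families of sections. -/
def sections (O : Opens X) : Submodule (Fn A O) (∀ i, Sec (D.module i) O) where
  carrier := {s | ∀ i j Q (h : Q ≤ O) (hi : Q ≤ V i) (hj : Q ≤ V j),
    D.tr i j Q hi hj (res _ h (s i)) = res _ h (s j)}
  add_mem' hs ht i j Q h hi hj := by
    simp only [Pi.add_apply, res_add, map_add, hs i j Q h hi hj, ht i j Q h hi hj]
  zero_mem' i j Q h hi hj := by
    have h0 (k) : res (D.module k) h 0 = 0 := map_zero ((D.module k).val.map (homOfLE h).op).hom
    simp only [Pi.zero_apply, h0, map_zero]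
  smul_mem' a s hs i j Q h hi hj := by
    simp only [Pi.smul_apply, res_smul, map_smul, hs i j Q h hi hj]

/-- Restriction of compatible families of sections. -/
def sectionsRes {O O' : Opens X} (h : O ≤ O') : D.sections O' →+ D.sections O where
  toFun s := ⟨fun i => res _ h (s.1 i), fun i j Q hQ hi hj => by
    rw [res_res, res_res]; exact s.2 i j Q (hQ.trans h) hi hj⟩
  map_zero' := Subtype.ext (funext fun k => map_zero ((D.module k).val.map (homOfLE h).op).hom)
  map_add' s t := Subtype.ext (funext fun i => res_add h _ _)

/-- The presheaf of compatible families of sections. -/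
def presheaf : (Opens X)ᵒᵖ ⥤ Ab.{u} where
  obj O := AddCommGrpCat.of (D.sections O.unop)
  map i := AddCommGrpCat.ofHom (D.sectionsRes i.unop.le)
  map_id O := by
    ext s i
    exact res_self _ _
  map_comp k l := by
    ext s i
    exact (res_res _ _ _).symm

instance (O : (Opens X)ᵒᵖ) : Module ((ringSheaf A).obj.obj O) (D.presheaf.obj O) :=
  inferInstanceAs (Module (Fn A O.unop) (D.sections O.unop))

/-- Each component glues in its own sheaf `D.module i`. The glued components match because matching
is a local condition, the transition maps being compatible with restriction. -/
lemma presheaf_isSheaf : TopCat.Presheaf.IsSheaf D.presheaf := by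
  rw [TopCat.Presheaf.isSheaf_iff_isSheafUniqueGluing]
  intro κ Q s hs
  let s' (k : κ) : D.sections (Q k) := s k
  have hs' (k l) (i) : res (D.module i) (inf_le_left : Q k ⊓ Q l ≤ Q k) ((s' k).1 i) =
      res (D.module i) (inf_le_right : Q k ⊓ Q l ≤ Q l) ((s' l).1 i) :=
    congrFun (congrArg Subtype.val (hs k l : D.sectionsRes inf_le_left (s' k) =
      D.sectionsRes inf_le_right (s' l))) i
  choose t ht ht' using fun i => existsUnique_section (D.module i) (fun k => le_iSup Q k) le_rfl
    (fun k => (s' k).1 i) (fun k l => hs' k l i)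
  refine ⟨(⟨t, fun i j O h hi hj => ?_⟩ : D.sections (iSup Q)), fun k => ?_, fun t' h' => ?_⟩
  -- Matching over `O` is tested on the cover by the `Q k ⊓ O`, where it is the matching of the
  -- components of `s' k`.
  · refine section_ext (D.module j) (Q := fun k => Q k ⊓ O) (fun k => inf_le_right) ?_ fun k => ?_
    · rw [← iSup_inf_eq]
      exact le_inf h le_rfl
    · have := (s' k).2 i j (Q k ⊓ O) inf_le_left (inf_le_right.trans hi) (inf_le_right.trans hj)
      rw [← ht i k, ← ht j k, res_res, res_res] at this
      rw [← D.tr_res, res_res, res_res]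
      exact this
  · exact Subtype.ext (funext fun i => ht i k)
  · exact Subtype.ext (funext fun i => ht' i ((t' : D.sections (iSup Q)).1 i) fun k =>
      congrFun (congrArg Subtype.val (h' k : D.sectionsRes (le_iSup Q k) t' = s' k)) i)

/-- The sheaf of modules obtained by gluing. -/
def glued : Modules A where
  val := PresheafOfModules.ofPresheaf D.presheaf (fun O _ k a s =>
    Subtype.ext (funext fun i => res_smul k.unop.le a ((s : D.sections O.unop).1 i)))
  isSheaf := D.presheaf_isSheaf

/-- Sections of the glued sheaf are compatible families. -/
def gluedSec (O : Opens X) : Sec D.glued O ≃ₗ[Fn A O] D.sections O := LinearEquiv.refl _ _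

/-- The projections from the glued sheaf. -/
def proj (i : ι) : D.glued ⟶ D.module i :=
  mkHom (fun O => LinearMap.proj i ∘ₗ (D.sections O).subtype ∘ₗ (D.gluedSec O).toLinearMap)
    (fun _ _ _ _ => rfl)

lemma tr_proj (i j : ι) (O : Opens X) (hi : O ≤ V i) (hj : O ≤ V j) (s) :
    D.tr i j O hi hj (ap (D.proj i) O s) = ap (D.proj j) O s := by
  have := (D.gluedSec O s).2 i j O le_rfl hi hj
  rwa [res_self, res_self] at this

lemma proj_ext (O : Opens X) {s t : Sec D.glued O} (h : ∀ i, ap (D.proj i) O s = ap (D.proj i) O t) :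
    s = t :=
  (D.gluedSec O).injective (Subtype.ext (funext h))

/-- Over `O ≤ V i` the `i`-th component determines every other component on `V j ⊓ O`, hence on `O`
by `res_bijective`. -/
lemma res_tr_proj {i : ι} (j : ι) {O : Opens X} (hi : O ≤ V i) (s) :
    res _ inf_le_right (ap (D.proj j) O s) = D.tr i j (V j ⊓ O) (inf_le_right.trans hi) inf_le_left
      (res _ inf_le_right (ap (D.proj i) O s)) :=
  ((D.gluedSec O s).2 i j _ inf_le_right _ _).symm

/-- Injectivity holds because the `i`-th component determines the others. For surjectivity the other
components are built from the `i`-th by the transition maps; the cocycle condition makes them match.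
-/
lemma proj_bijective (i : ι) (O : Opens X) (hi : O ≤ V i) : Function.Bijective (ap (D.proj i) O) := by
  constructor
  · intro s t h
    refine D.proj_ext O fun j => (D.res_bijective j O).1 ?_
    rw [res_tr_proj D j hi, h, ← res_tr_proj D j hi]
  · intro x
    -- The `j`-th component is forced on `V j ⊓ O`, and `res_bijective` extends it to `O`.
    choose s hs using fun j => (D.res_bijective j O).2
      (D.tr i j (V j ⊓ O) (inf_le_right.trans hi) inf_le_left (res _ inf_le_right x))
    have hs' (j) (Q) (h : Q ≤ O) (hj : Q ≤ V j) :
        res _ h (s j) = D.tr i j Q (h.trans hi) hj (res _ h x) := by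
      have := congrArg (res _ (le_inf hj h)) (hs j)
      rw [res_res, ← D.tr_res, res_res] at this
      exact this
    refine ⟨(D.gluedSec O).symm ⟨s, fun j k Q h hj hk => ?_⟩, ?_⟩
    -- Both components are transitions of `x`, so matching is the cocycle condition.
    · rw [hs' _ _ _ hj, hs' _ _ _ hk, D.tr_tr]
    · have := hs' i O le_rfl hi
      rw [res_self, res_self, D.tr_self] at this
      exact this

end GluingData

end

end SmoothStack

namespace SmoothStack

open CategoryTheory Opposite TopologicalSpace MonoidalCategory Limits

noncomputable section

open scoped Manifold ContDiff

attribute [-instance] CategoryTheory.catToReflQuiver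

/-! ### Inclusions of open submanifolds are open immersions. -/

namespace SmoothMan

/-- The value of a smooth function at a point. -/
def evalFn {U : SmoothMan} {O : Opens U.carrier} (a : Fn (smoothFn U) O) (x : O) : ℝ :=
  (show C^∞⟮𝓡 U.dim, O; 𝓘(ℝ), ℝ⟯ from a) x

lemma evalFn_ext {U : SmoothMan} {O : Opens U.carrier} {a b : Fn (smoothFn U) O}
    (h : ∀ x, evalFn a x = evalFn b x) : a = b :=
  ContMDiffMap.ext (f := (show C^∞⟮𝓡 U.dim, O; 𝓘(ℝ), ℝ⟯ from a)) h

lemma evalFn_co {T U : SmoothMan} (h : T ⟶ U) {O : Opens U.carrier} (a : Fn (smoothFn U) O)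
    (t : (Opens.map (cont h)).obj O) :
    evalFn (co (comap h) O a) t = evalFn a ⟨toFun h t.1, t.2⟩ := rfl

/-- A smooth map that is the inclusion of an open subset, up to diffeomorphism, is an open immersion
of ringed spaces. -/
lemma isOpenImm_comap {T U : SmoothMan} (h : T ⟶ U) (hh : Topology.IsOpenEmbedding (toFun h))
    (W : Opens U.carrier) (hW : Set.range (toFun h) = W) (s : openSub W ⟶ T)
    (hs : s ≫ h = ofOpen W) : IsOpenImm (comap h) W where
  isOpenEmbedding := hh
  range_eq := hW
  bijective O hO := by
    -- On its image `W`, the map `h` has the smooth inverse `s`.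
    have hs' (y : W) : toFun h (toFun s y) = y.1 := congr(toFun $hs y)
    constructor
    · intro a b hab
      refine evalFn_ext fun y => ?_
      have hy : toFun h (toFun s ⟨y.1, hO y.2⟩) = y.1 := hs' ⟨y.1, hO y.2⟩
      -- Every point `y` of `O` is `h (s y)`, so evaluation of the pulled-back functions at `s y`
      -- recovers their values at `y`.
      have := congrArg (fun c => evalFn c ⟨toFun s ⟨y.1, hO y.2⟩, by
        change toFun h _ ∈ O
        rw [hy]
        exact y.2⟩) hab
      simp only [evalFn_co, hy] at this
      exact this
    · intro a
      -- A function on the preimage descends to `O` by composition with `r`, the restriction of `s`.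
      let r : O → (Opens.map (cont h)).obj O := fun y => ⟨toFun s ⟨y.1, hO y.2⟩, by
        change toFun h _ ∈ O
        rw [hs']
        exact y.2⟩
      have hr : ContMDiff (𝓡 U.dim) (𝓡 T.dim) ∞ r :=
        (ContMDiff.subtypeVal_comp_iff (I := 𝓡 U.dim) (I' := 𝓡 T.dim) _ _).1
          ((contMDiff_toFun s).comp (contMDiff_inclusion (I := 𝓡 U.dim) hO))
      let a' : C^∞⟮𝓡 T.dim, (Opens.map (cont h)).obj O; 𝓘(ℝ), ℝ⟯ := a
      let b : C^∞⟮𝓡 U.dim, O; 𝓘(ℝ), ℝ⟯ := ⟨a' ∘ r, a'.contMDiff.comp hr⟩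
      refine ⟨b, evalFn_ext fun t => ?_⟩
      change evalFn a (r ⟨toFun h t.1, t.2⟩) = _
      congr 1
      -- The points `s (h t)` and `t` have the same image under the injective map `h`.
      exact Subtype.ext (hh.injective (hs' _))

variable {U : SmoothMan}

lemma isOpenImm_ofOpen (O : Opens U.carrier) : IsOpenImm (comap (ofOpen O)) O :=
  isOpenImm_comap (ofOpen O) O.isOpen.isOpenEmbedding_subtypeVal O Subtype.range_val (𝟙 _) rfl

lemma isOpenImm_ofLE {O O' : Opens U.carrier} (h : O ≤ O') :
    IsOpenImm (comap (ofLE h)) ((Opens.map (cont (ofOpen O'))).obj O) := by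
  have hr : Set.range (toFun (ofLE h)) = (Opens.map (cont (ofOpen O'))).obj O :=
    Set.range_inclusion h
  -- The image is the preimage of `O` in `O'`; the inverse regards a point of `O'` lying in `O` as a
  -- point of `O`.
  refine isOpenImm_comap (ofLE h) ⟨Topology.IsEmbedding.inclusion h, ?_⟩ _ hr
    (lift (ofOpen _ ≫ ofOpen O') fun t => t.2) rfl
  rw [hr]
  exact (Opens.map (cont (ofOpen O'))).obj O |>.isOpen

/-- Read as composition of the relations `ap f O x = y`; in this form it supplies the hypothesis
`hR` of the abstract lemmas on pseudofunctors. -/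
lemma ap_comp_eq {X : TopCat} {A : TopCat.Sheaf CommRingCat X} {M N P : Modules A} {f : M ⟶ N}
    {g : N ⟶ P} {O : Opens X} {x : Sec M O} {y : Sec N O} {z : Sec P O} (hf : ap f O x = y)
    (hg : ap g O y = z) : ap (f ≫ g) O x = z := by
  rw [ap_comp, hf, hg]

/-! ### Coherence isomorphisms on sections. -/

section etaOver

variable {S T V : SmoothMan}

/-- The canonical map from the sections of `M` over the preimage of `O` in `V` to the sections of
the inverse image of `M` over the preimage of `O` in `T`. -/
def etaOver (a : T ⟶ V) (v : V ⟶ U) (q : T ⟶ U) (h : a ≫ v = q) (M : Modules (smoothFn V))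
    (O : Opens U.carrier) (m : Sec M ((Opens.map (cont v)).obj O)) :
    Sec ((pull (comap a)).obj M) ((Opens.map (cont q)).obj O) :=
  res _ (by subst h; rfl) (eta (comap a) M _ m)

/-- The restriction in `etaOver` is along an equality of open sets. It allows all composites to `U`
to be replaced by one map `q`, and is trivial when `q` is the composite itself. -/
lemma etaOver_rfl (a : T ⟶ V) (v : V ⟶ U) (M : Modules (smoothFn V))
    (O : Opens U.carrier) (m : Sec M ((Opens.map (cont v)).obj O)) :
    etaOver a v (a ≫ v) rfl M O m = eta (comap a) M _ m := res_self _ _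

lemma etaOver_bijective (a : T ⟶ V) (v : V ⟶ U) (q : T ⟶ U) (h : a ≫ v = q)
    {W : Opens V.carrier} (ha : IsOpenImm (comap a) W) (M : Modules (smoothFn V))
    {O : Opens U.carrier} (hO : (Opens.map (cont v)).obj O ≤ W) :
    Function.Bijective (etaOver a v q h M O) := by
  subst h
  exact (res_bijective _ le_rfl le_rfl).comp (ha.eta_bijective M hO)

lemma etaOver_res (a : T ⟶ V) (v : V ⟶ U) (q : T ⟶ U) (h : a ≫ v = q) (M : Modules (smoothFn V))
    {O O' : Opens U.carrier} (hO : O ≤ O') (m) :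
    etaOver a v q h M O (res M ((Opens.map (cont v)).map (homOfLE hO)).le m) =
      res _ ((Opens.map (cont q)).map (homOfLE hO)).le (etaOver a v q h M O' m) := by
  rw [etaOver, etaOver, eta_res, res_res, res_res]

lemma ap_map_etaOver (a : T ⟶ V) (v : V ⟶ U) (q : T ⟶ U) (h : a ≫ v = q)
    {M N : Modules (smoothFn V)} (k : M ⟶ N) (O : Opens U.carrier) (m) :
    ap ((pull (comap a)).map k) _ (etaOver a v q h M O m) = etaOver a v q h N O (ap k _ m) := by
  rw [etaOver, ap_res, ap_map_eta, etaOver]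

/-- The underlying sheaf of modules of an object of a fibre of `PoVecInfty`. -/
abbrev mod (M : PoVecInfty.obj (.mk (op S))) : Modules (smoothFn S) :=
  PoissonModule.module (A := smoothFn S) M

/-- The underlying morphism of sheaves of modules of a morphism in a fibre of `PoVecInfty`. -/
def modHom {V W : PoVecInfty.obj (.mk (op S))} (f : V ⟶ W) :
    mod V ⟶ mod W :=
  PoissonModule.Hom.hom f

lemma modHom_id (V : PoVecInfty.obj (.mk (op S))) : modHom (𝟙 V) = 𝟙 _ := rfl

/-- Isolates the unfolding of the coherence isomorphism of `PoVecInfty`, so that `ap_compHom`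
applies to it. -/
lemma modHom_mapComp_hom (h : S ⟶ T) (a : T ⟶ V) (M : PoVecInfty.obj (.mk (op V))) :
    modHom ((PoVecInfty.mapComp a.op.toLoc h.op.toLoc).hom.toNatTrans.app M) =
      compHom (comap h) (comap a) (comap (h ≫ a)) (co_comap_comp h a)
        (mod M) := rfl

lemma modHom_mapComp_inv (h : S ⟶ T) (a : T ⟶ V) (M : PoVecInfty.obj (.mk (op V))) :
    modHom ((PoVecInfty.mapComp a.op.toLoc h.op.toLoc).inv.toNatTrans.app M) =
      compInv (comap h) (comap a) (comap (h ≫ a)) (co_comap_comp h a)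
        (mod M) := rfl

/-- The coherence isomorphism sends `η m` to `η (η m)`. Each composite is given only up to an
equality, as the axioms of descent require. -/
lemma ap_mapComp'_hom (h : S ⟶ T) (a : T ⟶ V) (ha : S ⟶ V) (e : h ≫ a = ha)
    (e' : a.op.toLoc ≫ h.op.toLoc = ha.op.toLoc) (v : V ⟶ U) (q : T ⟶ U)
    (hq : S ⟶ U) (e₁ : a ≫ v = q) (e₂ : h ≫ q = hq) (e₃ : ha ≫ v = hq)
    (M : PoVecInfty.obj (.mk (op V))) (O : Opens U.carrier) (m) :
    ap (M := (pull (comap ha)).obj (mod M)) (N := (pull (comap h)).obj ((pull (comap a)).obj (mod M)))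
      (modHom (V := (PoVecInfty.map ha.op.toLoc).toFunctor.obj M)
        (W := (PoVecInfty.map h.op.toLoc).toFunctor.obj
          ((PoVecInfty.map a.op.toLoc).toFunctor.obj M))
        ((PoVecInfty.mapComp' a.op.toLoc h.op.toLoc ha.op.toLoc e').hom.toNatTrans.app M)) _
        (etaOver ha v hq e₃ (mod M) O m) =
    etaOver h q hq e₂ _ O (etaOver a v q e₁ (mod M) O m) := by
  subst e e₁ e₂
  have := modHom_mapComp_hom h a M
  rw [← PoVecInfty.mapComp'_eq_mapComp] at this
  refine (congr(ap $this _ (etaOver (h ≫ a) v (h ≫ a ≫ v) e₃ (mod M) O m))).trans ?_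
  rw [etaOver_rfl, etaOver_rfl]
  refine Eq.trans ?_ (ap_compHom (comap h) (comap a) (comap (h ≫ a)) (co_comap_comp h a)
    (mod M) _ m)
  exact congrArg (ap _ _) (etaOver_rfl (h ≫ a) v (mod M) O m)

lemma ap_mapComp'_inv (h : S ⟶ T) (a : T ⟶ V) (ha : S ⟶ V) (e : h ≫ a = ha)
    (e' : a.op.toLoc ≫ h.op.toLoc = ha.op.toLoc) (v : V ⟶ U) (q : T ⟶ U)
    (hq : S ⟶ U) (e₁ : a ≫ v = q) (e₂ : h ≫ q = hq) (e₃ : ha ≫ v = hq)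
    (M : PoVecInfty.obj (.mk (op V))) (O : Opens U.carrier) (m) :
    ap (M := (pull (comap h)).obj ((pull (comap a)).obj (mod M))) (N := (pull (comap ha)).obj (mod M))
      (modHom (V := (PoVecInfty.map h.op.toLoc).toFunctor.obj
          ((PoVecInfty.map a.op.toLoc).toFunctor.obj M))
        (W := (PoVecInfty.map ha.op.toLoc).toFunctor.obj M)
        ((PoVecInfty.mapComp' a.op.toLoc h.op.toLoc ha.op.toLoc e').inv.toNatTrans.app M)) _
        (etaOver h q hq e₂ _ O (etaOver a v q e₁ (mod M) O m)) =
    etaOver ha v hq e₃ (mod M) O m := by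
  subst e e₁ e₂
  have := modHom_mapComp_inv h a M
  rw [← PoVecInfty.mapComp'_eq_mapComp] at this
  refine (congr(ap $this _ (etaOver h (a ≫ v) (h ≫ a ≫ v) rfl _ O
    (etaOver a v (a ≫ v) rfl (mod M) O m)))).trans ?_
  rw [etaOver_rfl, etaOver_rfl]
  exact (ap_compInv (comap h) (comap a) (comap (h ≫ a)) (co_comap_comp h a)
    (mod M) _ m).trans (etaOver_rfl (h ≫ a) v (mod M) O m).symm

open Pseudofunctor.LocallyDiscreteOpToCat in
-- `pullHom k h` is composed of a coherence isomorphism, the image of `k` and an inverse coherence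
-- isomorphism, so three relations compose. The general `F` and `R` keep this unfolding apart from
-- that of `PoVecInfty`.
lemma pullHom_rel {C : Type*} [Category* C] (F : Pseudofunctor (LocallyDiscrete Cᵒᵖ) Cat)
    {S T V V' : C} {M : F.obj (.mk (op V))} {M' : F.obj (.mk (op V'))}
    {a : T ⟶ V} {a' : T ⟶ V'} (k : (F.map a.op.toLoc).toFunctor.obj M ⟶
      (F.map a'.op.toLoc).toFunctor.obj M') (h : S ⟶ T)
    (ha : S ⟶ V) (ha' : S ⟶ V') (e : h ≫ a = ha) (e' : h ≫ a' = ha')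
    (X : F.obj (.mk (op S)) → Type*) (R : ∀ A B, (A ⟶ B) → X A → X B → Prop)
    (hR : ∀ A B C (f : A ⟶ B) (g : B ⟶ C) x y z, R A B f x y → R B C g y z → R A C (f ≫ g) x z)
    (e₄ : a.op.toLoc ≫ h.op.toLoc = ha.op.toLoc) 
    (e₄' : a'.op.toLoc ≫ h.op.toLoc = ha'.op.toLoc) (x y z w)
    (h₁ : R ((F.map ha.op.toLoc).toFunctor.obj M)
      ((F.map h.op.toLoc).toFunctor.obj ((F.map a.op.toLoc).toFunctor.obj M))
      ((F.mapComp' a.op.toLoc h.op.toLoc ha.op.toLoc e₄).hom.toNatTrans.app M) x y)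
    (h₂ : R _ _ ((F.map h.op.toLoc).toFunctor.map k) y z)
    (h₃ : R ((F.map h.op.toLoc).toFunctor.obj ((F.map a'.op.toLoc).toFunctor.obj M'))
      ((F.map ha'.op.toLoc).toFunctor.obj M')
      ((F.mapComp' a'.op.toLoc h.op.toLoc ha'.op.toLoc e₄').inv.toNatTrans.app M') z w) :
    R _ _ (pullHom k h ha ha' e e') x w :=
  hR _ _ _ _ _ _ _ _ h₁ (hR _ _ _ _ _ _ _ _ h₂ h₃)

open Pseudofunctor.LocallyDiscreteOpToCat in
-- Matching of sections survives inverse image along `h`, since each of the three factors of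
-- `pullHom` carries sections coming from below to sections coming from below.
lemma ap_pullHom {V' : SmoothMan} {M : PoVecInfty.obj (.mk (op V))} {M' : PoVecInfty.obj (.mk (op V'))}
    {a : T ⟶ V} {a' : T ⟶ V'} (k : (PoVecInfty.map a.op.toLoc).toFunctor.obj M ⟶
      (PoVecInfty.map a'.op.toLoc).toFunctor.obj M') (h : S ⟶ T)
    (ha : S ⟶ V) (ha' : S ⟶ V') (e : h ≫ a = ha) (e' : h ≫ a' = ha')
    (v : V ⟶ U) (v' : V' ⟶ U) (q : T ⟶ U) (e₁ : a ≫ v = q) (e₁' : a' ≫ v' = q) (hq : S ⟶ U)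
    (e₃ : ha ≫ v = hq) (e₃' : ha' ≫ v' = hq) (O : Opens U.carrier) (m m')
    (hk : ap (M := (pull (comap a)).obj (mod M)) (N := (pull (comap a')).obj (mod M'))
      (modHom k) _ (etaOver a v q e₁ (mod M) O m) = etaOver a' v' q e₁' (mod M') O m') :
    ap (M := (pull (comap ha)).obj (mod M)) (N := (pull (comap ha')).obj (mod M'))
      (modHom (pullHom k h ha ha' e e')) _ (etaOver ha v hq e₃ (mod M) O m) =
        etaOver ha' v' hq e₃' (mod M') O m' := by
  have e₂ : h ≫ q = hq := by rw [← e₁, ← e₃, ← e, Category.assoc]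
  have e₄ : a.op.toLoc ≫ h.op.toLoc = ha.op.toLoc := by rw [← e]; rfl
  have e₄' : a'.op.toLoc ≫ h.op.toLoc = ha'.op.toLoc := by rw [← e']; rfl
  have h₁ := ap_mapComp'_hom h a ha e e₄ v q hq e₁ e₂ e₃ M O m
  have h₂ := ap_map_etaOver h q hq e₂ (M := (pull (comap a)).obj (mod M))
    (N := (pull (comap a')).obj (mod M')) (modHom k) O (etaOver a v q e₁ (mod M) O m)
  have h₃ := ap_mapComp'_inv h a' ha' e' e₄' v' q hq e₁' e₂ e₃' M' O m'
  rw [hk] at h₂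
  exact pullHom_rel PoVecInfty k h ha ha' e e'
    (fun A => Sec (mod A) ((Opens.map (cont hq)).obj O)) (fun A B f x y => ap (modHom f) _ x = y)
    (fun _ _ _ _ _ _ _ _ => ap_comp_eq) e₄ e₄' _ _ _ _ h₁ h₂ h₃

/-- The canonical descent datum passes from `a^* f_i^* M` to `b^* f_j^* M` through `q^* M`. -/
lemma ofObj_hom_rel {C : Type*} [Category* C] (F : Pseudofunctor (LocallyDiscrete Cᵒᵖ) Cat)
    {U T : C} {ι : Type*} {W : ι → C} (f : ∀ i, W i ⟶ U) (M : F.obj (.mk (op U))) (q : T ⟶ U)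
    {i j : ι} (a : T ⟶ W i) (b : T ⟶ W j) (ha : a ≫ f i = q) (hb : b ≫ f j = q)
    (X : F.obj (.mk (op T)) → Type*) (R : ∀ A B, (A ⟶ B) → X A → X B → Prop)
    (hR : ∀ A B C (f : A ⟶ B) (g : B ⟶ C) x y z, R A B f x y → R B C g y z → R A C (f ≫ g) x z)
    (e : (f i).op.toLoc ≫ a.op.toLoc = q.op.toLoc)
    (e' : (f j).op.toLoc ≫ b.op.toLoc = q.op.toLoc) (x y z)
    (h₁ : R ((F.map a.op.toLoc).toFunctor.obj ((F.map (f i).op.toLoc).toFunctor.obj M))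
      ((F.map q.op.toLoc).toFunctor.obj M)
      ((F.mapComp' (f i).op.toLoc a.op.toLoc q.op.toLoc e).inv.toNatTrans.app M) x y)
    (h₂ : R ((F.map q.op.toLoc).toFunctor.obj M)
      ((F.map b.op.toLoc).toFunctor.obj ((F.map (f j).op.toLoc).toFunctor.obj M))
      ((F.mapComp' (f j).op.toLoc b.op.toLoc q.op.toLoc e').hom.toNatTrans.app M) y z) :
    R _ _ ((Pseudofunctor.DescentData.ofObj (f := f) M).hom q a b ha hb) x z :=
  hR _ _ _ _ _ _ _ _ h₁ h₂

lemma ap_ofObj_hom {ι : Type} {W : ι → SmoothMan} (f : ∀ i, W i ⟶ U)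
    (M : PoVecInfty.obj (.mk (op U))) (q : T ⟶ U) {i j : ι} (a : T ⟶ W i) (b : T ⟶ W j)
    (ha : a ≫ f i = q) (hb : b ≫ f j = q) (O : Opens U.carrier) (m : Sec (mod M) O) :
    ap (M := (pull (comap a)).obj ((pull (comap (f i))).obj (mod M)))
      (N := (pull (comap b)).obj ((pull (comap (f j))).obj (mod M)))
      (modHom ((Pseudofunctor.DescentData.ofObj (f := f) M).hom q a b ha hb)) _
      (etaOver a (f i) q ha _ O (eta (comap (f i)) (mod M) O m)) =
        etaOver b (f j) q hb _ O (eta (comap (f j)) (mod M) O m) := by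
  have e : (f i).op.toLoc ≫ a.op.toLoc = q.op.toLoc := by rw [← ha]; rfl
  have e' : (f j).op.toLoc ≫ b.op.toLoc = q.op.toLoc := by rw [← hb]; rfl
  -- The object `M` lives on `U`, so its structure map to `U` is the identity.
  have h₁ := ap_mapComp'_inv a (f i) q ha e (𝟙 U) (f i) q (Category.comp_id _) ha
    (Category.comp_id _) M O m
  have h₂ := ap_mapComp'_hom b (f j) q hb e' (𝟙 U) (f j) q (Category.comp_id _) hb
    (Category.comp_id _) M O m
  have e (i) : etaOver (f i) (𝟙 U) (f i) (Category.comp_id _) (mod M) O m =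
    eta (comap (f i)) (mod M) O m := res_self _ _
  rw [e] at h₁ h₂
  exact ofObj_hom_rel PoVecInfty f M q a b ha hb
    (fun A => Sec (mod A) ((Opens.map (cont q)).obj O)) (fun A B f x y => ap (modHom f) _ x = y)
    (fun _ _ _ _ _ _ _ _ => ap_comp_eq) _ _ _ _ _ h₁ h₂

end etaOver

end SmoothMan

end

end SmoothStack

namespace SmoothStack

open CategoryTheory Opposite TopologicalSpace MonoidalCategory Limits

noncomputable section

/-! ### Local morphisms and functions along an open immersion. -/

section

variable {X Y : TopCat.{u}} {A : TopCat.Sheaf CommRingCat.{u} X} {B : TopCat.Sheaf CommRingCat.{u} Y}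
  {f : X ⟶ Y} {φ : RingMap f A B} {V : Opens Y}

lemma coUnit_res {O O' : Opens Y} (h : O ≤ O') (a : Sec (unitM B) O') :
    coUnit φ O (res _ h a) = res _ ((Opens.map f).map (homOfLE h)).le (coUnit φ O' a) :=
  co_res φ h a

lemma tmul_res {M N : Modules A}
    {O O' : Opens X} (h : O ≤ O') (m : Sec M O') (n : Sec N O') :
    res (tens M N) h (tmul O' m n) = tmul O (res M h m) (res N h n) :=
  ((tmulBilin M N).res_app _ _ h m n).symm

lemma coUnit_smul (O : Opens Y) (a : Fn B O) (x : Sec (unitM B) O) :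
    coUnit φ O (a • x) = co φ O a • coUnit φ O x :=
  map_mul (co φ O) a ((unitSec B O).symm x)

variable (φ) in
/-- The direct image of a bilinear map. -/
def pushBilin {M N P : Modules A} (b : Bilin M N P) :
    Bilin ((push φ).obj M) ((push φ).obj N) ((push φ).obj P) where
  app O x y := (pushSec φ P O).symm (b.app _ (pushSec φ M O x) (pushSec φ N O y))
  add_left _ _ _ _ := b.add_left _ _ _ _
  add_right _ _ _ _ := b.add_right _ _ _ _
  smul_left _ _ _ _ := b.smul_left _ _ _ _
  smul_right _ _ _ _ := b.smul_right _ _ _ _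
  res_app _ _ _ _ _ := b.res_app _ _ _ _ _

namespace IsOpenImm

lemma coUnit_bijective (hφ : IsOpenImm φ V) {O : Opens Y} (hO : O ≤ V) :
    Function.Bijective (coUnit φ O) :=
  hφ.bijective O hO

/-- The image of `f` lies in `V`, so `O` and `V ⊓ O` have the same preimage. This reduces arguments
over an arbitrary `O` to subsets of `V`. -/
lemma map_le_map_inf (hφ : IsOpenImm φ V) (O : Opens Y) :
    (Opens.map f).obj O ≤ (Opens.map f).obj (V ⊓ O) := by
  intro t ht
  refine ⟨?_, ht⟩
  rw [← hφ.range_eq]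
  exact ⟨t, rfl⟩

/-- Morphisms from an inverse image are determined on the open subsets of the image of the open
immersion. -/
lemma hom_ext_of_le (hφ : IsOpenImm φ V) {M : Modules B} {N : Modules A}
    {g g' : (pull φ).obj M ⟶ N}
    (h : ∀ O ≤ V, ∀ x, ap g _ (eta φ M O x) = ap g' _ (eta φ M O x)) : g = g' := by
  refine pull_hom_ext φ fun O x => ?_
  apply (res_bijective N ((Opens.map f).map (homOfLE inf_le_right)).le (hφ.map_le_map_inf O)).1
  rw [← ap_res, ← ap_res]
  have := h (V ⊓ O) inf_le_left (res M inf_le_right x)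
  rwa [eta_res] at this

/-- The preimages of `O` and `V ⊓ O` agree, so sections may be restricted to `V ⊓ O`. -/
lemma pullTens_ext_of_le (hφ : IsOpenImm φ V) {M : Modules B} {P : Modules A}
    {g g' : tens ((pull φ).obj M) ((pull φ).obj M) ⟶ P}
    (h : ∀ O ≤ V, ∀ m n, ap g _ (tmul _ (eta φ M O m) (eta φ M O n)) =
      ap g' _ (tmul _ (eta φ M O m) (eta φ M O n))) : g = g' := by
  refine pullTens_ext φ fun O m n => ?_
  apply (res_bijective P ((Opens.map f).map (homOfLE inf_le_right)).le (hφ.map_le_map_inf O)).1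
  rw [← ap_res, ← ap_res, tmul_res]
  have := h (V ⊓ O) inf_le_left (res M inf_le_right m) (res M inf_le_right n)
  rwa [eta_res, eta_res] at this

/-- A morphism of inverse images along an open immersion with image `V`, as a morphism with values
in the sections over subsets of `V`. -/
def locHom (hφ : IsOpenImm φ V) {M N : Modules B} (g : (pull φ).obj M ⟶ (pull φ).obj N) :
    M ⟶ loc N V :=
  mkHom (fun O =>
    { toFun := fun x => (locSec N V O).symm ((hφ.etaEquiv N inf_le_left).symm
        (ap g _ (eta φ M (V ⊓ O) (res M inf_le_right x))))
      map_add' := fun x y => by rw [res_add, eta_add, map_add, map_add, map_add]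
      map_smul' := fun a x => by
        apply (locSec N V O).injective
        rw [RingHom.id_apply, locSec_smul, AddEquiv.apply_symm_apply, AddEquiv.apply_symm_apply]
        apply (hφ.eta_bijective N inf_le_left).1
        rw [eta_symm, eta_smul, eta_symm, res_smul, eta_smul, map_smul] })
    (fun O O' h x => by
      apply (locSec N V O).injective
      refine Eq.trans ?_ (locSec_res N V h _).symm
      apply (hφ.eta_bijective N inf_le_left).1
      rw [eta_res]
      change eta φ N _ ((hφ.etaEquiv N inf_le_left).symm _) =
        res _ _ (eta φ N _ ((hφ.etaEquiv N inf_le_left).symm _))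
      rw [eta_symm, eta_symm, res_res, ← ap_res, ← eta_res _ _ (inf_le_inf_left V h), res_res])

lemma eta_locHom (hφ : IsOpenImm φ V) {M N : Modules B} (g : (pull φ).obj M ⟶ (pull φ).obj N)
    (O : Opens Y) (x : Sec M O) :
    eta φ N (V ⊓ O) (locSec N V O (ap (hφ.locHom g) O x)) =
      ap g _ (eta φ M (V ⊓ O) (res M inf_le_right x)) :=
  hφ.eta_symm N inf_le_left _

/-- The inverse of `coUnit`. -/
def coUnitEquiv (hφ : IsOpenImm φ V) {O : Opens Y} (hO : O ≤ V) :
    Sec (unitM B) O ≃+ Sec (unitM A) ((Opens.map f).obj O) :=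
  AddEquiv.ofBijective (coUnit φ O) (hφ.coUnit_bijective hO)

lemma coUnit_symm (hφ : IsOpenImm φ V) {O : Opens Y} (hO : O ≤ V) (x) :
    coUnit φ O ((hφ.coUnitEquiv hO).symm x) = x :=
  (hφ.coUnitEquiv hO).apply_symm_apply x

/-- Functions on preimages, restricted to `V` and considered as functions on subsets of `V`. -/
def locUnitHom (hφ : IsOpenImm φ V) : (push φ).obj (unitM A) ⟶ loc (unitM B) V :=
  mkHom (fun O =>
    { toFun := fun x => (locSec _ V O).symm ((hφ.coUnitEquiv inf_le_left).symm
        (res (unitM A) ((Opens.map f).map (homOfLE inf_le_right)).le (pushSec φ _ O x)))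
      map_add' := fun x y => by rw [map_add, res_add, map_add, map_add]
      map_smul' := fun a x => by
        apply (locSec _ V O).injective
        rw [RingHom.id_apply, locSec_smul, AddEquiv.apply_symm_apply, AddEquiv.apply_symm_apply]
        apply (hφ.coUnit_bijective inf_le_left).1
        rw [coUnit_symm, coUnit_smul, coUnit_symm, pushSec_smul, res_smul, co_res] })
    (fun O O' h x => by
      apply (locSec _ V O).injective
      refine Eq.trans ?_ (locSec_res _ V h _).symm
      apply (hφ.coUnit_bijective inf_le_left).1
      rw [coUnit_res]
      change coUnit φ _ ((hφ.coUnitEquiv inf_le_left).symm _) =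
        res _ _ (coUnit φ _ ((hφ.coUnitEquiv inf_le_left).symm _))
      rw [coUnit_symm, coUnit_symm, pushSec_res, res_res, res_res])

lemma coUnit_locUnitHom (hφ : IsOpenImm φ V) (O : Opens Y) (x : Sec ((push φ).obj (unitM A)) O) :
    coUnit φ (V ⊓ O) (locSec _ V O (ap hφ.locUnitHom O x)) =
      res (unitM A) ((Opens.map f).map (homOfLE inf_le_right)).le (pushSec φ _ O x) :=
  hφ.coUnit_symm inf_le_left _

end IsOpenImm

end

lemma PoissonModule.Hom.ap_pairing {X : TopCat.{u}} {A : TopCat.Sheaf CommRingCat.{u} X}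
    {M N : PoissonModule A} (g : M ⟶ N) (O : Opens X) (x y : Sec M.module O) :
    ap N.pairing O (tmul O (ap (PoissonModule.Hom.hom g) O x) (ap (PoissonModule.Hom.hom g) O y)) =
      ap M.pairing O (tmul O x y) := by
  rw [← ap_tensMap, ← ap_comp, PoissonModule.Hom.comm g]

/-! ### Gluing morphisms of Poisson modules. -/

section cover

variable {Y : TopCat.{u}} {B : TopCat.Sheaf CommRingCat.{u} Y} {ι : Type*} {X : ι → TopCat.{u}}
  {A : ∀ i, TopCat.Sheaf CommRingCat.{u} (X i)} {f : ∀ i, X i ⟶ Y}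
  {φ : ∀ i, RingMap (f i) (A i) B} {V : ι → Opens Y}

/-- Morphisms of inverse images to the members of an open cover glue. -/
lemma exists_module_hom (hφ : ∀ i, IsOpenImm (φ i) (V i)) (hV : iSup V = ⊤) {M N : Modules B}
    (ψ : ∀ i, (pull (φ i)).obj M ⟶ (pull (φ i)).obj N)
    (hψ : ∀ i j O, O ≤ V i → O ≤ V j → ∀ x y y', ap (ψ i) _ (eta (φ i) M O x) = eta (φ i) N O y →
      ap (ψ j) _ (eta (φ j) M O x) = eta (φ j) N O y' → y = y') :
    ∃ k : M ⟶ N, ∀ i O, O ≤ V i → ∀ x,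
      eta (φ i) N O (ap k O x) = ap (ψ i) _ (eta (φ i) M O x) := by
  -- The maps `ψ i` and `ψ j` have different targets, so `hψ` compares their values as sections `y`,
  -- `y'` of `N`; these are the values of the two `locHom`s.
  obtain ⟨k, hk⟩ := exists_glue_hom hV (fun i => (hφ i).locHom (ψ i)) fun i j O hi hj x => by
    refine hψ i j O hi hj x _ _ ?_ ?_
    · rw [eta_res, (hφ i).eta_locHom, ← ap_res, ← eta_res _ _ (le_inf hi le_rfl), res_res, res_self]
    · rw [eta_res, (hφ j).eta_locHom, ← ap_res, ← eta_res _ _ (le_inf hj le_rfl), res_res, res_self]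
  refine ⟨k, fun i O hO x => ?_⟩
  have h := congrArg (fun s => eta (φ i) N O (res N (le_inf hO le_rfl) s)) (hk i O x)
  dsimp only at h
  rw [res_res, res_self, eta_res, (hφ i).eta_locHom, ← ap_res, ← eta_res _ _ (le_inf hO le_rfl),
    res_res, res_self] at h
  exact h

/-- Morphisms of Poisson modules glue. -/
lemma exists_poisson_hom (hφ : ∀ i, IsOpenImm (φ i) (V i)) (hV : iSup V = ⊤) {M N : PoissonModule B}
    (ψ : ∀ i, (PoissonModule.pullback (φ i)).obj M ⟶ (PoissonModule.pullback (φ i)).obj N)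
    (hψ : ∀ i j O, O ≤ V i → O ≤ V j → ∀ x y y',
      ap (ψ i).hom _ (eta (φ i) M.module O x) = eta (φ i) N.module O y →
      ap (ψ j).hom _ (eta (φ j) M.module O x) = eta (φ j) N.module O y' → y = y') :
    ∃ k : M ⟶ N, ∀ i, (PoissonModule.pullback (φ i)).map k = ψ i := by
  obtain ⟨k, hk⟩ := exists_module_hom hφ hV (fun i => (ψ i).hom) hψ
  refine ⟨⟨k, tens_hom_ext fun O m n => section_ext_cover hV fun i => ?_⟩, fun i =>
    PoissonModule.hom_ext ((hφ i).hom_ext_of_le fun O hO x => ?_)⟩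
  -- An equality of functions can be checked on each `V i ⊓ O` after the injective map `coUnit`,
  -- where it is the compatibility of `ψ i` with the pairings.
  · rw [← ap_res, ← ap_res, tmul_res, ap_comp, ap_tensMap]
    apply ((hφ i).coUnit_bijective inf_le_left).1
    rw [← ap_pullPairing, ← ap_pullPairing, hk i _ inf_le_left, hk i _ inf_le_left]
    exact PoissonModule.Hom.ap_pairing (ψ i) _ _ _
  · exact (ap_map_eta (φ i) k O x).trans (hk i O hO x)

/-- Morphisms of Poisson modules that agree on the members of an open cover are equal. -/
lemma poisson_hom_ext (hφ : ∀ i, IsOpenImm (φ i) (V i)) (hV : iSup V = ⊤) {M N : PoissonModule B}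
    {k k' : M ⟶ N}
    (h : ∀ i, (PoissonModule.pullback (φ i)).map k = (PoissonModule.pullback (φ i)).map k') :
    k = k' := by
  refine PoissonModule.hom_ext (ap_ext fun O x => section_ext_cover hV fun i => ?_)
  rw [← ap_res, ← ap_res]
  apply ((hφ i).eta_bijective N.module inf_le_left).1
  rw [← ap_map_eta, ← ap_map_eta]
  exact congr(ap (PoissonModule.Hom.hom $(h i)) _ _)

end cover

/-! ### Gluing Poisson modules. -/

section glue

variable {Y : TopCat.{u}} {B : TopCat.Sheaf CommRingCat.{u} Y} {ι : Type u} {X : ι → TopCat.{u}}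
  {A : ∀ i, TopCat.Sheaf CommRingCat.{u} (X i)} {f : ∀ i, X i ⟶ Y}
  {φ : ∀ i, RingMap (f i) (A i) B} {V : ι → Opens Y} {N : ∀ i, PoissonModule (A i)}

/-- Transition maps between Poisson modules `N i` over the members of an open cover. -/
structure PoissonGluing (φ : ∀ i, RingMap (f i) (A i) B) (V : ι → Opens Y)
    (N : ∀ i, PoissonModule (A i)) where
  tr : ∀ i j O, O ≤ V i → O ≤ V j → (Sec (N i).module ((Opens.map (f i)).obj O) →+
    Sec (N j).module ((Opens.map (f j)).obj O))
  tr_smul : ∀ i j O (hi : O ≤ V i) (hj : O ≤ V j) (a : Fn B O) x,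
    tr i j O hi hj (co (φ i) O a • x) = co (φ j) O a • tr i j O hi hj x
  tr_res : ∀ i j O O' (h : O ≤ O') (hi : O' ≤ V i) (hj : O' ≤ V j) x,
    tr i j O (h.trans hi) (h.trans hj) (res _ ((Opens.map (f i)).map (homOfLE h)).le x) =
      res _ ((Opens.map (f j)).map (homOfLE h)).le (tr i j O' hi hj x)
  tr_self : ∀ i O (hi : O ≤ V i) x, tr i i O hi hi x = x
  tr_tr : ∀ i j k O (hi : O ≤ V i) (hj : O ≤ V j) (hk : O ≤ V k) x,
    tr j k O hj hk (tr i j O hi hj x) = tr i k O hi hk x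
  -- The two pairings take values in functions on different spaces; they are compared through a
  -- function `c` on `O`.
  tr_pairing : ∀ i j O (hi : O ≤ V i) (hj : O ≤ V j) x y (c : Sec (unitM B) O),
    coUnit (φ i) O c = ap (N i).pairing _ (tmul _ x y) →
      coUnit (φ j) O c = ap (N j).pairing _ (tmul _ (tr i j O hi hj x) (tr i j O hi hj y))

namespace PoissonGluing

/-- The gluing data on the direct images. -/
def toGluingData (D : PoissonGluing φ V N) (hφ : ∀ i, IsOpenImm (φ i) (V i)) :
    GluingData B V where
  module i := (push (φ i)).obj (N i).module
  res_bijective i O := res_bijective (N i).module _ ((hφ i).map_le_map_inf O)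
  tr i j O hi hj :=
    { toFun := fun x => (pushSec (φ j) _ O).symm (D.tr i j O hi hj (pushSec (φ i) _ O x))
      map_add' := fun _ _ => (D.tr i j O hi hj).map_add _ _
      map_smul' := fun a _ => D.tr_smul i j O hi hj a _ }
  tr_res i j O O' h hi hj _ := D.tr_res i j O O' h hi hj _
  tr_self i O hi _ := D.tr_self i O hi _
  tr_tr i j k O hi hj hk _ := D.tr_tr i j k O hi hj hk _

variable (D : PoissonGluing φ V N) (hφ : ∀ i, IsOpenImm (φ i) (V i))

/-- The component of a glued section. -/
def comp (i : ι) (O : Opens Y) (w : Sec (D.toGluingData hφ).glued O) :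
    Sec (N i).module ((Opens.map (f i)).obj O) :=
  pushSec (φ i) (N i).module O (ap ((D.toGluingData hφ).proj i) O w)

lemma tr_comp (i j : ι) (O : Opens Y) (hi : O ≤ V i) (hj : O ≤ V j)
    (w : Sec (D.toGluingData hφ).glued O) :
    D.tr i j O hi hj (D.comp hφ i O w) = D.comp hφ j O w :=
  (D.toGluingData hφ).tr_proj i j O hi hj w

lemma comp_bijective (i : ι) (O : Opens Y) (hi : O ≤ V i) : Function.Bijective (D.comp hφ i O) :=
  (D.toGluingData hφ).proj_bijective i O hi

/-- Over `O ≤ V i` two glued sections are paired through their `i`-th components, and the value is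
regarded as a function on `O`. By `tr_pairing` the choice of `i` does not matter on overlaps, so
these local forms glue. -/
lemma exists_bilin (hφ : ∀ i, IsOpenImm (φ i) (V i)) (hV : iSup V = ⊤) :
    ∃ c : Bilin (D.toGluingData hφ).glued (D.toGluingData hφ).glued (unitM B),
      ∀ i O, O ≤ V i → ∀ x y, coUnit (φ i) O (c.app O x y) =
        ap (N i).pairing _ (tmul _ (D.comp hφ i O x) (D.comp hφ i O y)) := by
  -- For `O ≤ V i`, moving a function on the preimage to `O` by `locUnitHom` and back by `coUnit`
  -- changes nothing.
  have key (i) (O : Opens Y) (hi : O ≤ V i) (z : Sec ((push (φ i)).obj (unitM (A i))) O) :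
      coUnit (φ i) O (res _ (le_inf hi le_rfl) (locSec _ (V i) O (ap (hφ i).locUnitHom O z))) =
        pushSec (φ i) _ O z := by
    rw [coUnit_res, (hφ i).coUnit_locUnitHom, res_res, res_self]
  obtain ⟨c, hc⟩ := exists_glue_bilin hV (D.toGluingData hφ).proj (D.toGluingData hφ).proj
    (fun i => (pushBilin (φ i) ((tmulBilin _ _).comp (N i).pairing)).comp (hφ i).locUnitHom)
    fun i j O hi hj x y => by
      apply ((hφ j).coUnit_bijective hj).1
      refine (D.tr_pairing i j O hi hj (D.comp hφ i O x) (D.comp hφ i O y) _ (key i O hi _)).trans ?_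
      rw [tr_comp, tr_comp]
      exact (key j O hj _).symm
  refine ⟨c, fun i O hi x y => ?_⟩
  have h := congrArg (fun s => coUnit (φ i) O (res _ (le_inf hi le_rfl) s)) (hc i O x y)
  dsimp only at h
  rw [res_res, res_self] at h
  exact h.trans (key i O hi _)

/-- Poisson modules over the members of an open cover glue. -/
lemma exists_glued (hφ : ∀ i, IsOpenImm (φ i) (V i)) (hV : iSup V = ⊤) :
    ∃ (W : PoissonModule B) (e : ∀ i, (PoissonModule.pullback (φ i)).obj W ≅ N i),
      ∀ i j O (hi : O ≤ V i) (hj : O ≤ V j) (w : Sec W.module O),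
        D.tr i j O hi hj (ap (M := (pull (φ i)).obj W.module) (PoissonModule.Hom.hom (e i).hom) _
            (eta (φ i) W.module O w)) =
          ap (M := (pull (φ j)).obj W.module) (PoissonModule.Hom.hom (e j).hom) _
            (eta (φ j) W.module O w) := by
  obtain ⟨c, hc⟩ := D.exists_bilin hφ hV
  -- The adjoint of the `i`-th projection; it is an isomorphism because the projection is bijective
  -- over subsets of `V i`.
  let g (i) : (pull (φ i)).obj (D.toGluingData hφ).glued ⟶ (N i).module :=
    ((adj (φ i)).homEquiv _ _).symm ((D.toGluingData hφ).proj i)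
  have hg (i O w) : ap (g i) _ (eta (φ i) _ O w) = D.comp hφ i O w := ap_lift_eta (φ i) _ O w
  have hp (i) : tensMap (g i) (g i) ≫ (N i).pairing = pullPairing (φ i) c.lift :=
    (hφ i).pullTens_ext_of_le fun O hO m n => by
      rw [ap_comp, ap_tensMap, ap_pullPairing, c.ap_lift, hc i O hO, hg, hg]
  let W : PoissonModule B :=
    { module := (D.toGluingData hφ).glued
      pairing := c.lift
      -- Antisymmetry is local, and on `V i ⊓ O` the glued form is the pairing of `N i`.
      antisymm := tens_hom_ext fun O m n => section_ext_cover hV fun i => by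
        have ha := congr(ap $((N i).antisymm) _ (tmul _ (D.comp hφ i _ (res _ inf_le_right m))
          (D.comp hφ i (V i ⊓ O) (res _ inf_le_right n))))
        rw [ap_comp, ap_tensSwap] at ha
        apply ((hφ i).coUnit_bijective inf_le_left).1
        rw [ap_comp, ap_tensSwap, ← ap_res, ← ap_res, tmul_res, tmul_res]
        have hneg : ap (-c.lift) (V i ⊓ O) (tmul _ (res _ inf_le_right m) (res _ inf_le_right n)) =
          -ap c.lift (V i ⊓ O) (tmul _ (res _ inf_le_right m) (res _ inf_le_right n)) := rfl
        rw [hneg, map_neg, c.ap_lift, c.ap_lift, hc i _ inf_le_left, hc i _ inf_le_left, ha]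
        rfl }
  let e (i) : (PoissonModule.pullback (φ i)).obj W ≅ N i :=
    PoissonModule.isoMk (isoOfBijective (g i) ((hφ i).bijective_of_eta (g i) fun O hO => by
        simp only [hg]
        exact D.comp_bijective hφ i O hO))
      (hp i)
  refine ⟨W, e, fun i j O hi hj w => ?_⟩
  exact (congrArg (D.tr i j O hi hj) (hg i O w)).trans
    ((D.tr_comp hφ i j O hi hj w).trans (hg j O w).symm)

end PoissonGluing

end glue

end
end SmoothStack

namespace SmoothStack

open CategoryTheory Opposite TopologicalSpace MonoidalCategory Limits

noncomputable section

attribute [-instance] CategoryTheory.catToReflQuiver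

namespace SmoothMan

variable {U : SmoothMan} {ι : Type} {V : ι → Opens U.carrier}

lemma isOpenImm_inter₂_p₁ (i j : ι) : IsOpenImm (comap (inter₂ V i j).p₁)
    ((Opens.map (cont (ofOpen (V i)))).obj (V i ⊓ V j)) :=
  isOpenImm_ofLE inf_le_left

lemma isOpenImm_inter₂_p₂ (i j : ι) : IsOpenImm (comap (inter₂ V i j).p₂)
    ((Opens.map (cont (ofOpen (V j)))).obj (V i ⊓ V j)) :=
  isOpenImm_ofLE inf_le_right

/-! ### Corresponding sections over intersections. -/

section corr

variable {i j : ι} {M : PoVecInfty.obj (.mk (op (openSub (V i))))}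
  {N : PoVecInfty.obj (.mk (op (openSub (V j))))}

/-- The morphism of sheaves of modules underlying a morphism between the inverse images to
`V i ⊓ V j`. -/
def interHom (k : (PoVecInfty.map (inter₂ V i j).p₁.op.toLoc).toFunctor.obj M ⟶
      (PoVecInfty.map (inter₂ V i j).p₂.op.toLoc).toFunctor.obj N) :
    (pull (comap (inter₂ V i j).p₁)).obj (mod M) ⟶ (pull (comap (inter₂ V i j).p₂)).obj (mod N) :=
  modHom k

/-- Sections over the preimages of `O` that correspond to each other under a morphism between the
inverse images to `V i ⊓ V j`. -/
def Corr (k : (PoVecInfty.map (inter₂ V i j).p₁.op.toLoc).toFunctor.obj M ⟶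
      (PoVecInfty.map (inter₂ V i j).p₂.op.toLoc).toFunctor.obj N) (O : Opens U.carrier)
    (x : Sec (mod M) ((Opens.map (cont (ofOpen (V i)))).obj O))
    (y : Sec (mod N) ((Opens.map (cont (ofOpen (V j)))).obj O)) : Prop :=
  ap (interHom k) _
    (etaOver (inter₂ V i j).p₁ (ofOpen (V i)) (inter₂ V i j).p (inter₂ V i j).hp₁ (mod M) O x) =
  etaOver (inter₂ V i j).p₂ (ofOpen (V j)) (inter₂ V i j).p (inter₂ V i j).hp₂ (mod N) O y

variable (k : (PoVecInfty.map (inter₂ V i j).p₁.op.toLoc).toFunctor.obj M ⟶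
      (PoVecInfty.map (inter₂ V i j).p₂.op.toLoc).toFunctor.obj N) {O : Opens U.carrier}

/-- The part of `O ≤ V i` that lies in `V j` is already in `V i ⊓ V j`, so `O ≤ V j` need not be
assumed. -/
lemma etaOver_p₂_bijective (hO : O ≤ V i) : Function.Bijective
    (etaOver (inter₂ V i j).p₂ (ofOpen (V j)) (inter₂ V i j).p (inter₂ V i j).hp₂ (mod N) O) :=
  etaOver_bijective _ _ _ _ (isOpenImm_inter₂_p₂ i j) _ fun t ht => ⟨hO ht, t.2⟩

/-- Together with `Corr.unique` this makes `Corr k O` the graph of a function when `O ≤ V i`. -/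
lemma corr_exists (hO : O ≤ V i) (x) : ∃ y, Corr k O x y := by
  obtain ⟨y, hy⟩ := (etaOver_p₂_bijective (N := N) (j := j) hO).2
    (ap (interHom k) _
      (etaOver (inter₂ V i j).p₁ (ofOpen (V i)) (inter₂ V i j).p (inter₂ V i j).hp₁ (mod M) O x))
  exact ⟨y, hy.symm⟩

variable {k}

lemma Corr.unique (hO : O ≤ V i) {x y y'} (h : Corr k O x y) (h' : Corr k O x y') : y = y' :=
  (etaOver_p₂_bijective (N := N) (j := j) hO).1 (h.symm.trans h')

lemma etaOver_add {S T W : SmoothMan} (a : T ⟶ W) (v : W ⟶ S) (q : T ⟶ S) (h : a ≫ v = q)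
    (M : Modules (smoothFn W)) (O : Opens S.carrier) (x y) :
    etaOver a v q h M O (x + y) = etaOver a v q h M O x + etaOver a v q h M O y := by
  rw [etaOver, eta_add, res_add, etaOver, etaOver]

lemma etaOver_smul {S T W : SmoothMan} (a : T ⟶ W) (v : W ⟶ S) (q : T ⟶ S) (h : a ≫ v = q)
    (M : Modules (smoothFn W)) (O : Opens S.carrier) (r : Fn (smoothFn S) O) (x) :
    etaOver a v q h M O (co (comap v) O r • x) = co (comap q) O r • etaOver a v q h M O x := by
  subst h
  rw [etaOver_rfl, etaOver_rfl, eta_smul]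
  rfl

lemma Corr.add {x y x' y'} (h : Corr k O x y) (h' : Corr k O x' y') : Corr k O (x + x') (y + y') := by
  rw [Corr] at h h' ⊢
  rw [etaOver_add, etaOver_add, map_add, h, h']

lemma Corr.smul {x y} (h : Corr k O x y) (r : Fn (smoothFn U) O) :
    Corr k O (co (comap (ofOpen (V i))) O r • x) (co (comap (ofOpen (V j))) O r • y) := by
  rw [Corr] at h ⊢
  rw [etaOver_smul, etaOver_smul, map_smul, h]

lemma Corr.res {O' : Opens U.carrier} (hO : O ≤ O') {x y} (h : Corr k O' x y) :
    Corr k O (SmoothStack.res (mod M) ((Opens.map (cont (ofOpen (V i)))).map (homOfLE hO)).le x)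
      (SmoothStack.res (mod N) ((Opens.map (cont (ofOpen (V j)))).map (homOfLE hO)).le y) := by
  rw [Corr] at h ⊢
  rw [etaOver_res _ _ _ _ _ hO, etaOver_res _ _ _ _ _ hO, ap_res, h]

/-- A morphism on `V i ⊓ V j` is determined by its values on sections coming from `V i`, and it
suffices to test open sets of `U` contained in both members. -/
lemma corr_hom_ext {k' : (PoVecInfty.map (inter₂ V i j).p₁.op.toLoc).toFunctor.obj M ⟶
      (PoVecInfty.map (inter₂ V i j).p₂.op.toLoc).toFunctor.obj N}
    (h : ∀ O, O ≤ V i → O ≤ V j → ∀ x, ∃ y, Corr k O x y ∧ Corr k' O x y) : k = k' := by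
  have hm : interHom k = interHom k' := by
    refine (isOpenImm_inter₂_p₁ i j).hom_ext_of_le fun Q hQ x => ?_
    -- An open subset of `V i` is the preimage of its image in `U`.
    obtain ⟨O, hO, rfl⟩ : ∃ O ≤ V i ⊓ V j, (Opens.map (cont (ofOpen (V i)))).obj O = Q :=
      have hi := isOpenImm_ofOpen (V i)
      ⟨hi.im Q, hi.injOn_map (hi.im_le Q) ((hi.map_im Q).le.trans hQ), hi.map_im Q⟩
    have e : etaOver (inter₂ V i j).p₁ (ofOpen (V i)) (inter₂ V i j).p (inter₂ V i j).hp₁ (mod M) O x =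
      eta (comap (inter₂ V i j).p₁) (mod M) _ x := res_self _ _
    obtain ⟨y, h₁, h₂⟩ := h O (hO.trans inf_le_left) (hO.trans inf_le_right) x
    exact (congrArg (ap (interHom k) _) e).symm.trans
      (h₁.trans (h₂.symm.trans (congrArg (ap (interHom k') _) e)))
  exact PoissonModule.hom_ext hm

/-- `ap_pullPairing` computes the inverse image of a pairing on sections coming from below; the
value is expressed by a function `c` on the base. -/
lemma coUnit_eq_pairing_etaOver {S T W : SmoothMan} (a : T ⟶ W) (v : W ⟶ S) (q : T ⟶ S)
    (h : a ≫ v = q) (M : PoissonModule (smoothFn W)) (O : Opens S.carrier) (x y)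
    (c : Sec (unitM (smoothFn S)) O)
    (hc : coUnit (comap v) O c = ap M.pairing _ (tmul _ x y)) :
    coUnit (comap q) O c = ap (pullPairing (comap a) M.pairing) _
      (tmul _ (etaOver a v q h M.module O x) (etaOver a v q h M.module O y)) := by
  subst h
  rw [etaOver_rfl, etaOver_rfl]
  exact (congrArg (coUnit (comap a) _) hc).trans (ap_pullPairing (comap a) M.pairing _ x y).symm

/-- Corresponding sections have corresponding pairings. -/
lemma Corr.pairing {x y x' y'} (h : Corr k O x y) (h' : Corr k O x' y') (hi : O ≤ V i)
    (c : Sec (unitM (smoothFn U)) O)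
    (hc : coUnit (comap (ofOpen (V i))) O c =
      ap (PoissonModule.pairing (A := smoothFn (openSub (V i))) M) _ (tmul _ x x')) :
    coUnit (comap (ofOpen (V j))) O c =
      ap (PoissonModule.pairing (A := smoothFn (openSub (V j))) N) _ (tmul _ y y') := by
  have h₁ := coUnit_eq_pairing_etaOver (inter₂ V i j).p₁ (ofOpen (V i)) (inter₂ V i j).p
    (inter₂ V i j).hp₁ M O x x' c hc
  have h₂ := PoissonModule.Hom.ap_pairing
    (M := (PoissonModule.pullback (comap (inter₂ V i j).p₁)).obj M)
    (N := (PoissonModule.pullback (comap (inter₂ V i j).p₂)).obj N) k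
    ((Opens.map (cont (inter₂ V i j).p)).obj O)
    (etaOver (inter₂ V i j).p₁ (ofOpen (V i)) (inter₂ V i j).p (inter₂ V i j).hp₁ (mod M) O x)
    (etaOver (inter₂ V i j).p₁ (ofOpen (V i)) (inter₂ V i j).p (inter₂ V i j).hp₁ (mod M) O x')
  -- Since `k` preserves pairings, the pairing of the images of `y` and `y'` on `V i ⊓ V j` is the
  -- pullback of `c`.
  have h₃ := (congrArg₂ (fun s t => ap (pullPairing (comap (inter₂ V i j).p₂)
    (PoissonModule.pairing (A := smoothFn (openSub (V j))) N)) _ (tmul _ s t)) h h').symm.trans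
    (h₂.trans h₁.symm)
  -- As `O ≤ V i`, functions on the part of `O` in `V j` are determined by their pullbacks to `V i ⊓
  -- V j`.
  apply ((isOpenImm_inter₂_p₂ i j).coUnit_bijective (fun t ht => ⟨hi ht, t.2⟩ :
    (Opens.map (cont (ofOpen (V j)))).obj O ≤
      (Opens.map (cont (ofOpen (V j)))).obj (V i ⊓ V j))).1
  have e (y) : etaOver (inter₂ V i j).p₂ (ofOpen (V j)) (inter₂ V i j).p (inter₂ V i j).hp₂ (mod N) O y =
    eta (comap (inter₂ V i j).p₂) (mod N) _ y := res_self _ _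
  exact h₃.symm.trans ((congrArg₂ (fun s t => ap (pullPairing (comap (inter₂ V i j).p₂)
    (PoissonModule.pairing (A := smoothFn (openSub (V j))) N)) _ (tmul _ s t)) (e y) (e y')).trans
    (ap_pullPairing (comap (inter₂ V i j).p₂)
      (PoissonModule.pairing (A := smoothFn (openSub (V j))) N) _ y y'))

end corr

end SmoothMan

end

end SmoothStack

namespace SmoothStack

open CategoryTheory Opposite TopologicalSpace MonoidalCategory Limits

noncomputable section

attribute [-instance] CategoryTheory.catToReflQuiver

namespace SmoothMan

/-! ### The axioms of descent in terms of corresponding sections. -/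

section rel

open Pseudofunctor.DescentData' Pseudofunctor.LocallyDiscreteOpToCat

variable {C : Type*} [Category* C] {F : Pseudofunctor (LocallyDiscrete Cᵒᵖ) Cat} {ι : Type*} {U : C}
  {W : ι → C} {f : ∀ i, W i ⟶ U} {sq : ∀ i j, ChosenPullback (f i) (f j)}
  {sq₃ : ∀ i j k, ChosenPullback₃ (sq i j) (sq j k) (sq i k)} (D : F.DescentData' sq sq₃)
  {T : C} {X : F.obj (.mk (op T)) → Type*}
  (R : ∀ {A B : F.obj (.mk (op T))}, (A ⟶ B) → X A → X B → Prop)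

/-- `D.hom i i` is `pullHom'` along the two projections, and `pullHom'` along a repeated map is the
identity. The family `s`, indexed by maps, lets the equality of the projections be substituted
although the types depend on them. -/
lemma hom_self_rel (i : ι) {X : F.obj (.mk (op (sq i i).pullback)) → Type*}
    (R : ∀ {A B : F.obj (.mk (op (sq i i).pullback))}, (A ⟶ B) → X A → X B → Prop)
    (hR : ∀ A x, R (𝟙 A) x x) (h : (sq i i).p₁ = (sq i i).p₂)
    (s : ∀ a : (sq i i).pullback ⟶ W i, a ≫ f i = (sq i i).p →
      X ((F.map a.op.toLoc).toFunctor.obj (D.obj i))) :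
    R (D.hom i i) (s (sq i i).p₁ (sq i i).hp₁) (s (sq i i).p₂ (sq i i).hp₂) := by
  rw [← pullHom'_p₁_p₂ D.hom i i]
  -- The projections become variables `a` and `b`, so that their equality can be eliminated.
  have key (a b : (sq i i).pullback ⟶ W i) (ha : a ≫ f i = (sq i i).p) (hb : b ≫ f i = (sq i i).p)
      (hab : a = b) : R (pullHom' D.hom (sq i i).p a b ha hb) (s a ha) (s b hb) := by
    subst hab
    rw [D.pullHom'_self (sq i i).p a ha]
    exact hR _ _
  exact key _ _ _ _ h

/-- `pullHom'` is `pullHom` along the map to the fibre product induced by `a` and `b`;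
quantification over `p` avoids naming this map. -/
lemma pullHom'_rel {i j : ι} (q : T ⟶ U) (a : T ⟶ W i) (b : T ⟶ W j)
    (ha : a ≫ f i = q) (hb : b ≫ f j = q) (x y)
    (h : ∀ p h₁ h₂, R (pullHom (D.hom i j) p a b h₁ h₂) x y) :
    R (pullHom' D.hom q a b ha hb) x y :=
  h _ _ _

lemma pullHom'_trans_rel
    (hR : ∀ {A B C} (f : A ⟶ B) (g : B ⟶ C) x y z, R f x y → R g y z → R (f ≫ g) x z)
    {i j k : ι} (q : T ⟶ U) (a : T ⟶ W i) (b : T ⟶ W j) (c : T ⟶ W k)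
    (ha : a ≫ f i = q) (hb : b ≫ f j = q) (hc : c ≫ f k = q) (x y z)
    (h : R (pullHom' D.hom q a b ha hb) x y) (h' : R (pullHom' D.hom q b c hb hc) y z) :
    R (pullHom' D.hom q a c ha hc) x z := by
  rw [← D.comp_pullHom' q a b c ha hb hc]
  exact hR _ _ _ _ _ h h'

end rel

variable {U : SmoothMan} {ι : Type} {V : ι → Opens U.carrier}

section descentData

open Pseudofunctor.DescentData' Pseudofunctor.LocallyDiscreteOpToCat

variable (D : PoVecInfty.DescentData' (inter₂ V) (inter₃ V))

/-- Both projections of `V i ⊓ V i` are the same inclusion into `V i`, so the normalisation of the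
descent datum applies. -/
lemma corr_self (i : ι) (O : Opens U.carrier) (x) : Corr (D.hom i i) O x x :=
  hom_self_rel D i (X := fun A => Sec (mod A) ((Opens.map (cont (inter₂ V i i).p)).obj O))
    (fun f x y => ap (modHom f) _ x = y) (fun _ x => by rw [modHom_id, ap_id]) rfl
    (fun a ha => etaOver a (ofOpen (V i)) _ ha (mod (D.obj i)) O x)

variable {D} in
lemma Corr.ap_pullHom' {i j : ι} {O : Opens U.carrier} {x y} (h : Corr (D.hom i j) O x y)
    {T : SmoothMan} (q : T ⟶ U) (a : T ⟶ openSub (V i)) (b : T ⟶ openSub (V j))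
    (ha : a ≫ ofOpen (V i) = q) (hb : b ≫ ofOpen (V j) = q) :
    ap (M := (pull (comap a)).obj (mod (D.obj i))) (N := (pull (comap b)).obj (mod (D.obj j)))
      (modHom (pullHom' D.hom q a b ha hb)) _ (etaOver a (ofOpen (V i)) q ha (mod (D.obj i)) O x) =
    etaOver b (ofOpen (V j)) q hb (mod (D.obj j)) O y :=
  pullHom'_rel D (X := fun A => Sec (mod A) ((Opens.map (cont q)).obj O))
    (fun f x y => ap (modHom f) _ x = y) q a b ha hb _ _ fun p h₁ h₂ =>
      ap_pullHom (D.hom i j) p a b h₁ h₂ (ofOpen (V i)) (ofOpen (V j)) (inter₂ V i j).p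
        (inter₂ V i j).hp₁ (inter₂ V i j).hp₂ q ha hb O x y h

-- The cocycle condition is applied on `O` itself, regarded as a manifold over `V i`, `V j` and `V
-- k`, in place of the triple intersection.
variable {D} in
lemma Corr.trans {i j k : ι} {O : Opens U.carrier} (hi : O ≤ V i) (hj : O ≤ V j) (hk : O ≤ V k)
    {x y z} (h : Corr (D.hom i j) O x y) (h' : Corr (D.hom j k) O y z) : Corr (D.hom i k) O x z := by
  -- The section `z'` that does correspond to `x` is compared with `z` on `O`, where sections from
  -- `V k` are detected faithfully.
  obtain ⟨z', hz'⟩ := corr_exists (D.hom i k) hi x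
  have h₁ := h.ap_pullHom' (ofOpen O) (ofLE hi) (ofLE hj) rfl rfl
  have h₂ := h'.ap_pullHom' (ofOpen O) (ofLE hj) (ofLE hk) rfl rfl
  have h₃ := hz'.ap_pullHom' (ofOpen O) (ofLE hi) (ofLE hk) rfl rfl
  have h₄ := pullHom'_trans_rel D (X := fun A => Sec (mod A) ((Opens.map (cont (ofOpen O))).obj O))
    (fun f x y => ap (modHom f) _ x = y) (fun _ _ _ _ _ => ap_comp_eq) (ofOpen O) (ofLE hi)
    (ofLE hj) (ofLE hk) rfl rfl rfl _ _ _ h₁ h₂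
  have := (etaOver_bijective (ofLE hk) (ofOpen (V k)) (ofOpen O) rfl (isOpenImm_ofLE hk)
    (mod (D.obj k)) le_rfl).1 (h₄.symm.trans h₃)
  rwa [this]

end descentData

end SmoothMan

end

end SmoothStack

namespace SmoothStack

open CategoryTheory Opposite TopologicalSpace MonoidalCategory Limits

noncomputable section

attribute [-instance] CategoryTheory.catToReflQuiver

namespace SmoothMan

variable {U : SmoothMan} {ι : Type} {V : ι → Opens U.carrier}

/-! ### Transition maps of a descent datum. -/

section corr

variable {i j : ι} {M M' : PoVecInfty.obj (.mk (op (openSub (V i))))}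
  {N N' : PoVecInfty.obj (.mk (op (openSub (V j))))}
  (k : (PoVecInfty.map (inter₂ V i j).p₁.op.toLoc).toFunctor.obj M ⟶
      (PoVecInfty.map (inter₂ V i j).p₂.op.toLoc).toFunctor.obj N) {O : Opens U.carrier}

lemma interHom_map_comp (g : M' ⟶ M) :
    interHom ((PoVecInfty.map (inter₂ V i j).p₁.op.toLoc).toFunctor.map g ≫ k) =
      (pull (comap (inter₂ V i j).p₁)).map (modHom g) ≫ interHom k := rfl

lemma interHom_comp_map (g : N ⟶ N') :
    interHom (k ≫ (PoVecInfty.map (inter₂ V i j).p₂.op.toLoc).toFunctor.map g) =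
      interHom k ≫ (pull (comap (inter₂ V i j).p₂)).map (modHom g) := rfl

lemma corr_map_comp (g : M' ⟶ M) (x y) :
    Corr ((PoVecInfty.map (inter₂ V i j).p₁.op.toLoc).toFunctor.map g ≫ k) O x y ↔
      Corr k O (ap (modHom g) _ x) y := by
  rw [Corr, Corr, interHom_map_comp, ap_comp, ap_map_etaOver]

variable {k} in
lemma Corr.comp_map (g : N ⟶ N') {x y} (h : Corr k O x y) :
    Corr (k ≫ (PoVecInfty.map (inter₂ V i j).p₂.op.toLoc).toFunctor.map g) O x
      (ap (modHom g) _ y) := by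
  rw [Corr] at h ⊢
  rw [interHom_comp_map, ap_comp, h, ap_map_etaOver]

end corr

/-- Morphisms of descent data preserve corresponding sections. -/
lemma Corr.map {D D' : PoVecInfty.DescentData' (inter₂ V) (inter₃ V)} (ψ : D ⟶ D') {i j : ι}
    {O : Opens U.carrier} {x y} (h : Corr (D.hom i j) O x y) :
    Corr (D'.hom i j) O (ap (modHom (ψ.hom i)) _ x) (ap (modHom (ψ.hom j)) _ y) := by
  have := h.comp_map (ψ.hom j)
  rw [← ψ.comm i j] at this
  exact (corr_map_comp _ _ _ _).1 this

/-- The canonical descent data of an object. -/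
lemma corr_toDescent (M : PoVecInfty.obj (.mk (op U))) (i j : ι) (O : Opens U.carrier)
    (m : Sec (mod M) O) :
    Corr (M := (PoVecInfty.map (ofOpen (V i)).op.toLoc).toFunctor.obj M)
      (N := (PoVecInfty.map (ofOpen (V j)).op.toLoc).toFunctor.obj M)
      (((toDescent PoVecInfty V).obj M).hom i j) O (eta (comap (ofOpen (V i))) (mod M) O m)
      (eta (comap (ofOpen (V j))) (mod M) O m) :=
  ap_ofObj_hom (fun i => ofOpen (V i)) M (inter₂ V i j).p (inter₂ V i j).p₁ (inter₂ V i j).p₂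
    (inter₂ V i j).hp₁ (inter₂ V i j).hp₂ O m

/-- The transition maps given by a descent datum. -/
def gluing (D : PoVecInfty.DescentData' (inter₂ V) (inter₃ V)) :
    PoissonGluing (fun i => comap (ofOpen (V i))) V
      (fun i => (show PoissonModule (smoothFn (openSub (V i))) from D.obj i)) where
  -- Values are chosen by `corr_exists`. Each identity holds by uniqueness, as `Corr` is stable
  -- under the operation in question.
  tr i j _ hi _ := AddMonoidHom.mk' (fun x => (corr_exists (D.hom i j) hi x).choose)
    fun x y => (corr_exists (D.hom i j) hi (x + y)).choose_spec.unique hi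
      ((corr_exists (D.hom i j) hi x).choose_spec.add (corr_exists (D.hom i j) hi y).choose_spec)
  tr_smul i j _ hi _ a x := (corr_exists (D.hom i j) hi _).choose_spec.unique hi
    ((corr_exists (D.hom i j) hi x).choose_spec.smul a)
  tr_res i j _ _ h hi _ x := (corr_exists (D.hom i j) (h.trans hi) _).choose_spec.unique
    (h.trans hi) ((corr_exists (D.hom i j) hi x).choose_spec.res h)
  tr_self i _ hi x := (corr_exists (D.hom i i) hi x).choose_spec.unique hi (corr_self D i _ x)
  tr_tr i j k _ hi hj hk x := ((corr_exists (D.hom i j) hi x).choose_spec.trans hi hj hk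
    (corr_exists (D.hom j k) hj _).choose_spec).unique hi
      (corr_exists (D.hom i k) hi x).choose_spec
  tr_pairing i j _ hi _ x y c hc := (corr_exists (D.hom i j) hi x).choose_spec.pairing
    (corr_exists (D.hom i j) hi y).choose_spec hi c hc

lemma corr_gluing_tr (D : PoVecInfty.DescentData' (inter₂ V) (inter₃ V)) (i j O) (hi : O ≤ V i)
    (hj : O ≤ V j) (x) : Corr (D.hom i j) O x ((gluing D).tr i j O hi hj x) :=
  (corr_exists (D.hom i j) hi x).choose_spec

lemma Corr.congr {i j : ι} {M : PoVecInfty.obj (.mk (op (openSub (V i))))}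
    {N : PoVecInfty.obj (.mk (op (openSub (V j))))}
    {k : (PoVecInfty.map (inter₂ V i j).p₁.op.toLoc).toFunctor.obj M ⟶
      (PoVecInfty.map (inter₂ V i j).p₂.op.toLoc).toFunctor.obj N} {O : Opens U.carrier}
    {x x' y y'} (h : Corr k O x y) (hx : x = x') (hy : y = y') : Corr k O x' y' :=
  hx ▸ hy ▸ h

/-! ### The functor to descent data is an equivalence. -/

lemma toDescent_faithful (hV : iSup V = ⊤) : (toDescent PoVecInfty V).Faithful where
  map_injective {M N} _ _ h :=
    poisson_hom_ext (M := M) (N := N) (φ := fun i => comap (ofOpen (V i)))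
      (fun i => isOpenImm_ofOpen (V i)) hV
      fun i => congrArg (fun t => Pseudofunctor.DescentData'.Hom.hom t i) h

/-- Let `y`, `y'` be the values of `ψ i`, `ψ j` on `x`. The section of `y` on `V i` corresponds to
that of `y` on `V j` canonically, and to that of `y'` because `ψ` preserves correspondence. Hence `y
= y'`, and the `ψ i` glue. -/
lemma toDescent_full (hV : iSup V = ⊤) : (toDescent PoVecInfty V).Full where
  map_surjective {M N} ψ := by
    obtain ⟨k, hk⟩ := exists_poisson_hom (M := M) (N := N) (φ := fun i => comap (ofOpen (V i)))
      (fun i => isOpenImm_ofOpen (V i)) hV (fun i => ψ.hom i) fun i j O hi hj x y y' hy hy' =>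
        ((isOpenImm_ofOpen (V j)).eta_bijective (mod N) hj).1
          ((corr_toDescent N i j O y).unique hi
            (((corr_toDescent M i j O x).map ψ).congr hy hy'))
    exact ⟨k, Pseudofunctor.DescentData'.hom_ext hk⟩

/-- The last clause of `exists_glued` says that the isomorphisms `e i` carry the images of one
section of `W` to corresponding sections, which is compatibility with the descent data. -/
lemma toDescent_essSurj (hV : iSup V = ⊤) : (toDescent PoVecInfty V).EssSurj where
  mem_essImage D := by
    obtain ⟨W, e, he⟩ := (gluing D).exists_glued (fun i => isOpenImm_ofOpen (V i)) hV
    let W' : PoVecInfty.obj (.mk (op U)) := W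
    let e' (i) : ((toDescent PoVecInfty V).obj W').obj i ≅ D.obj i := e i
    refine ⟨W', ⟨Pseudofunctor.DescentData'.isoMk e' fun i j => corr_hom_ext fun O hi hj x => ?_⟩⟩
    obtain ⟨w, rfl⟩ := ((isOpenImm_ofOpen (V i)).eta_bijective W.module hi).2 x
    -- The common partner is the image under `e j` of the section of `w` on `V j`.
    refine ⟨_, (corr_map_comp _ _ _ _).2 ?_, (corr_toDescent W' i j O w).comp_map (e' j).hom⟩
    exact (corr_gluing_tr D i j O hi hj _).congr rfl (he i j O hi hj w)

end SmoothMan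

end

end SmoothStack

theorem mainTheorem10 : SmoothStack.IsStack SmoothStack.PoVecInfty := by
  intro U ι V hV
  exact
    { faithful := SmoothStack.SmoothMan.toDescent_faithful hV
      full := SmoothStack.SmoothMan.toDescent_full hV
      essSurj := SmoothStack.SmoothMan.toDescent_essSurj hV }
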